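/- Let $N\ge 1$, $0<\alpha\le 2$, $p>1+\alpha/N$, and let $u_0\in L^1(\mathbb{R}^N)$ be nonnegative and not almost everywhere zero. Let $\Lambda^\alpha=(-\Delta)^{\alpha/2}$ be the operator with Fourier symbol $|\xi|^\alpha$, i.e. $\widehat{\Lambda^\alpha\varphi}(\xi)=|\xi|^\alpha\widehat\varphi(\xi)$ with $\widehat\varphi(\xi)=\int_{\mathbb{R}^N} e^{-ix\cdot\xi}\varphi(x)\,dx$. Let $u=u(x,t)\ge 0$ be a global weak solution of $$\partial_t u=-\Lambda^\alpha u-u^p\quad (x\in\mathbb{R}^N,\ t>0),\qquad u(x,0)=u_0(x),$$ in the following sense: $u(t)\in L^1(\mathbb{R}^N)$ for every $t>0$, $u\in L^1(\mathbb{R}^N\times(0,T))$ for every $T>0$, $u^p$ is integrable on $K\times(0,T)$ for every compact $K\subset\mathbb{R}^N$ and every $T>0$, and for every $\varphi\in C_c^\infty(\mathbb{R}^N)$ and every $t>0$ $$\int_{\mathbb{R}^N} u(x,t)\varphi(x)\,dx=\int_{\mathbb{R}^N} u_0(x)\varphi(x)\,dx-\int_0^t\!\int_{\mathbb{R}^N}\big(u(x,s)\,\Lambda^\alpha\varphi(x)+u(x,s)^p\varphi(x)\big)\,dx\,ds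 .$$ Then the mass $M(t)=\int_{\mathbb{R}^N}u(x,t)\,dx$ has a limit $M_\infty=\lim_{t\to\infty}M(t)$, and $0<M_\infty<\infty$. Moreover, for every $q\in[1,\infty)$, $$t^{\frac N\alpha\left(1-\frac1q\right)}\,\|u(t)-M_\infty P_\alpha(t)\|_{L^q(\mathbb{R}^N)}\to 0\quad\text{as } t\to\infty,$$ where $P_\alpha(x,t)=(2\pi)^{-N}\int_{\mathbb{R}^N}e^{ix\cdot\xi-t|\xi|^\alpha}\,d\xi$ is the fundamental solution of $u_t+\Lambda^\alpha u=0$. -/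

import Mathlib

open MeasureTheory Filter Topology Set
open scoped FourierTransform ContDiff

/-- The fractional Laplacian `Λ^α = (-Δ)^{α/2}` on (smooth, compactly supported, real) functions,
defined through the Fourier transform as the operator with symbol `|ξ|^α`. Mathlib's Fourier
transform uses the character `exp (-2πi⟨x, ξ⟩)`, hence the symbol is `(2π‖ξ‖)^α`.
The function computed is real because the symbol is real and even. -/
noncomputable def fracLaplacian {N : ℕ} (α : ℝ) (φ : EuclideanSpace ℝ (Fin N) → ℝ)
    (x : EuclideanSpace ℝ (Fin N)) : ℝ :=
  (𝓕⁻ (fun ξ : EuclideanSpace ℝ (Fin N) =>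
    (((2 * Real.pi * ‖ξ‖) ^ α : ℝ) : ℂ) *
      𝓕 (fun y : EuclideanSpace ℝ (Fin N) => (φ y : ℂ)) ξ) x).re

/-- The fundamental solution `P_α(x,t)` of `u_t + Λ^α u = 0` on `ℝ^N`, i.e. the function with
Fourier transform `exp (-t |ξ|^α)`:
`P_α(x,t) = (2π)^{-N} ∫ exp (i⟨x, ξ⟩ - t |ξ|^α) dξ = ∫ exp (2πi⟨x, ξ⟩ - t (2π|ξ|)^α) dξ`. -/
noncomputable def fundSol {N : ℕ} (α t : ℝ) (x : EuclideanSpace ℝ (Fin N)) : ℝ :=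
  (𝓕⁻ (fun ξ : EuclideanSpace ℝ (Fin N) =>
    ((Real.exp (-(t * (2 * Real.pi * ‖ξ‖) ^ α)) : ℝ) : ℂ)) x).re

/-- `u` (written `u t x`, for times `t > 0`) is a global nonnegative weak solution of
`u_t = -Λ^α u + lam * u^p` on `ℝ^N × (0,∞)` with initial datum `u₀`, having finite mass. -/
structure IsNonnegWeakSolution {N : ℕ} (α lam p : ℝ) (u₀ : EuclideanSpace ℝ (Fin N) → ℝ)
    (u : ℝ → EuclideanSpace ℝ (Fin N) → ℝ) : Prop where
  /-- nonnegativity -/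
  nonneg : ∀ t : ℝ, 0 < t → ∀ᵐ x, 0 ≤ u t x
  /-- `u(t) ∈ L¹(ℝ^N)` for each time -/
  integrable_slice : ∀ t : ℝ, 0 < t → Integrable (u t)
  /-- `u ∈ L¹(ℝ^N × (0,T))` for each `T` -/
  integrable_time : ∀ T : ℝ, 0 < T →
    IntegrableOn (fun z : ℝ × EuclideanSpace ℝ (Fin N) => u z.1 z.2) (Ioc 0 T ×ˢ univ)
  /-- `u^p` is locally integrable on `ℝ^N × [0,∞)` -/
  integrable_pow : ∀ T : ℝ, 0 < T → ∀ K : Set (EuclideanSpace ℝ (Fin N)), IsCompact K →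
    IntegrableOn (fun z : ℝ × EuclideanSpace ℝ (Fin N) => u z.1 z.2 ^ p) (Ioc 0 T ×ˢ K)
  /-- the equation and the initial condition, tested against `C_c^∞(ℝ^N)` -/
  weak_eq : ∀ φ : EuclideanSpace ℝ (Fin N) → ℝ, ContDiff ℝ ∞ φ → HasCompactSupport φ →
    ∀ t : ℝ, 0 < t →
      ∫ x, u t x * φ x =
        (∫ x, u₀ x * φ x) +
          ∫ s in (0 : ℝ)..t, ∫ x, (-(u s x * fracLaplacian α φ x) + lam * u s x ^ p * φ x)

/-! The absorption term only removes mass, so `u` lies below the linear flow: for `0 < s < t`, `u(t)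
≤ e^{-(t-s)Λ^α} u(s)` almost everywhere (`IsNonnegWeakSolution.ae_le_heatConv`). The kernel bound
`P_α(t) ≤ C t^{-N/α}` then gives `u(t) ≤ A t^{-N/α}`. Writing `u^p = u · u^{p-1}`, the mass lost on
`(s, t]` is at most `M(s) · D ∫_s^t τ^{-γ} dτ` with `γ = N(p-1)/α`. The hypothesis `p > 1 + α/N`
says exactly that `γ > 1`, so the tail integral is small for large `s` and at least half of `M(s)`
survives forever. As the same inequality excludes extinction in finite time (`mass_pos`), `M_∞ > 0`.

For the profile, compare `u(t)` with the linear evolution of `u(s)`. By the ordering above, their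
`L¹` distance equals `M(s) - M(t)`. The linear evolution approaches `M(s) P_α(t)` in `L¹` by
self-similarity and Scheffé's lemma, and `M(s) P_α(t)` is at `L¹` distance `M(s) - M_∞` from the
target. Letting first `t` and then `s` grow gives the case `q = 1`; interpolation with the `L^∞`
decay gives every finite `q`.

Two ingredients need real work. The first is `P_α ≥ 0`, where `α ≤ 2` enters: `r^{α/2}` is an
integral of the functions `1 - e^{-sr}` against a positive measure, so `e^{-t|ξ|^α}` is a limit of
positive combinations of Gaussians. The second is Duhamel's formula for weak solutions tested only
against `C_c^∞`. Testing with modulated cut-offs `c χ(εx) e^{2πi⟨x,η⟩}` and letting `ε → 0` gives an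
integrated linear ODE for each Fourier mode. It is solved by variation of constants and returned to
physical space by pairing with a nonnegative test function. -/

/-! ### Profiles with nonnegative Gaussian-regularised cosine transform -/

section GaussianPositivity

variable {V : Type*} [NormedAddCommGroup V] [InnerProductSpace ℝ V] [FiniteDimensional ℝ V]
  [MeasurableSpace V] [BorelSpace V]

lemma integrable_exp_neg_mul_norm_sq {ε : ℝ} (hε : 0 < ε) :
    Integrable (fun ξ : V => Real.exp (-(ε * ‖ξ‖ ^ 2))) := by
  have h := (GaussianFourier.integrable_cexp_neg_mul_sq_norm_add (V := V) (b := (ε : ℂ))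
    (by simpa using hε) 0 0).norm
  refine h.congr (ae_of_all _ fun ξ => ?_)
  simp only [Complex.norm_exp]
  congr 1
  simp [← Complex.ofReal_pow, ← Complex.ofReal_mul]

lemma integral_gaussian_mul_cos_nonneg {ε : ℝ} (hε : 0 < ε) (x : V) :
    0 ≤ ∫ ξ : V, Real.exp (-(ε * ‖ξ‖ ^ 2)) * Real.cos (2 * Real.pi * inner ℝ ξ x) := by
  have hb : 0 < ((ε : ℂ)).re := by simpa using hε
  have h := fourier_gaussian_innerProductSpace (V := V) hb x
  have h2 : ∫ ξ : V, Real.exp (-(ε * ‖ξ‖ ^ 2)) * Real.cos (2 * Real.pi * inner ℝ ξ x)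
      = (𝓕 (fun v : V => Complex.exp (-(ε : ℂ) * ‖v‖ ^ 2)) x).re := by
    rw [Real.fourier_eq', ← RCLike.re_eq_complex_re, ← integral_re]
    · congr 1
      ext ξ
      have : Complex.exp (-(ε : ℂ) * ‖ξ‖ ^ 2) = ((Real.exp (-(ε * ‖ξ‖ ^ 2)) : ℝ) : ℂ) := by
        push_cast; congr 1; ring
      rw [this, RCLike.re_eq_complex_re, smul_eq_mul, Complex.re_mul_ofReal, Complex.exp_re]
      simp [mul_comm]
    · have := (Real.fourierIntegral_convergent_iff (μ := volume) (V := V)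
        (f := fun v : V => Complex.exp (-(ε : ℂ) * ‖v‖ ^ 2)) x).2 (by
          simpa using GaussianFourier.integrable_cexp_neg_mul_sq_norm_add (V := V) hb 0 0)
      simpa [Circle.smul_def, Real.fourierChar_apply] using this
  rw [h2, h]
  have e1 : ((Real.pi : ℂ) / ε) ^ (Module.finrank ℝ V / 2 : ℂ)
      = (((Real.pi / ε) ^ (Module.finrank ℝ V / 2 : ℝ) : ℝ) : ℂ) := by
    rw [Complex.ofReal_cpow (by positivity)]; push_cast; rfl
  have e2 : Complex.exp (-(Real.pi : ℂ) ^ 2 * ‖x‖ ^ 2 / ε)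
      = ((Real.exp (-Real.pi ^ 2 * ‖x‖ ^ 2 / ε) : ℝ) : ℂ) := by push_cast; rfl
  rw [e1, e2, ← Complex.ofReal_mul, Complex.ofReal_re]
  positivity

/-- A bounded measurable radial profile `g` such that, after any Gaussian regularisation,
`ξ ↦ g (‖ξ‖ ^ 2)` has a nonnegative cosine transform on `V`. -/
structure GaussianPositive (V : Type*) [NormedAddCommGroup V] [InnerProductSpace ℝ V]
    [FiniteDimensional ℝ V] [MeasurableSpace V] [BorelSpace V] (g : ℝ → ℝ) : Prop where
  measurable : Measurable g
  bounded : ∃ C, ∀ r, 0 ≤ r → |g r| ≤ C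
  nonneg : ∀ ε : ℝ, 0 < ε → ∀ x : V,
    0 ≤ ∫ ξ : V, g (‖ξ‖ ^ 2) * (Real.exp (-(ε * ‖ξ‖ ^ 2)) * Real.cos (2 * Real.pi * inner ℝ ξ x))

namespace GaussianPositive

lemma integrable {g : ℝ → ℝ} (hg : GaussianPositive V g) {ε : ℝ} (hε : 0 < ε) (x : V) :
    Integrable fun ξ : V =>
      g (‖ξ‖ ^ 2) * (Real.exp (-(ε * ‖ξ‖ ^ 2)) * Real.cos (2 * Real.pi * inner ℝ ξ x)) := by
  obtain ⟨C, hC⟩ := hg.bounded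
  refine ((integrable_exp_neg_mul_norm_sq (V := V) hε).const_mul C).mono' ?_ (ae_of_all _ ?_)
  · have := hg.measurable
    exact Measurable.aestronglyMeasurable (by fun_prop)
  · intro ξ
    rw [norm_mul, norm_mul, Real.norm_eq_abs, Real.norm_eq_abs, Real.norm_eq_abs, Real.abs_exp]
    have h1 := hC (‖ξ‖ ^ 2) (by positivity)
    have h2 := Real.abs_cos_le_one (2 * Real.pi * inner ℝ ξ x)
    have h3 := Real.exp_pos (-(ε * ‖ξ‖ ^ 2))
    exact mul_le_mul h1 (mul_le_of_le_one_right h3.le h2) (by positivity)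
      ((abs_nonneg _).trans h1)

lemma one : GaussianPositive V fun _ => 1 :=
  ⟨measurable_const, ⟨1, by simp⟩, fun ε hε x => by
    simpa using integral_gaussian_mul_cos_nonneg hε x⟩

lemma add {f g : ℝ → ℝ} (hf : GaussianPositive V f) (hg : GaussianPositive V g) :
    GaussianPositive V fun r => f r + g r := by
  obtain ⟨A, hA⟩ := hf.bounded
  obtain ⟨B, hB⟩ := hg.bounded
  refine ⟨hf.measurable.add hg.measurable,
    ⟨A + B, fun r hr => (abs_add_le _ _).trans (add_le_add (hA r hr) (hB r hr))⟩,
    fun ε hε x => ?_⟩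
  simp_rw [add_mul]
  rw [integral_add (hf.integrable hε x) (hg.integrable hε x)]
  exact add_nonneg (hf.nonneg ε hε x) (hg.nonneg ε hε x)

lemma const_mul {g : ℝ → ℝ} (hg : GaussianPositive V g) {c : ℝ} (hc : 0 ≤ c) :
    GaussianPositive V fun r => c * g r := by
  obtain ⟨B, hB⟩ := hg.bounded
  refine ⟨hg.measurable.const_mul c, ⟨c * B, fun r hr => ?_⟩, fun ε hε x => ?_⟩
  · rw [abs_mul, abs_of_nonneg hc]
    exact mul_le_mul_of_nonneg_left (hB r hr) hc
  · simp_rw [mul_assoc c]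
    rw [integral_const_mul]
    exact mul_nonneg hc (hg.nonneg ε hε x)

/-- The extra factor merges with the Gaussian regulariser, replacing `ε` by `ε + s`; this is why
positivity is required for every `ε`. -/
lemma exp_mul {g : ℝ → ℝ} (hg : GaussianPositive V g) {s : ℝ} (hs : 0 ≤ s) :
    GaussianPositive V fun r => Real.exp (-(s * r)) * g r := by
  obtain ⟨B, hB⟩ := hg.bounded
  have := hg.measurable
  refine ⟨by fun_prop, ⟨B, fun r hr => ?_⟩, fun ε hε x => ?_⟩
  · rw [abs_mul, Real.abs_exp]
    have : Real.exp (-(s * r)) ≤ 1 := Real.exp_le_one_iff.2 (by have := mul_nonneg hs hr; linarith)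
    exact (mul_le_of_le_one_left (abs_nonneg _) this).trans (hB r hr)
  · convert hg.nonneg (ε + s) (by linarith) x using 2
    ext ξ
    rw [show -((ε + s) * ‖ξ‖ ^ 2) = -(s * ‖ξ‖ ^ 2) + -(ε * ‖ξ‖ ^ 2) by ring, Real.exp_add]
    ring

/-- The regulariser supplies the integrable majorant, so bounded pointwise convergence of profiles
is enough. -/
lemma of_tendsto {G : ℕ → ℝ → ℝ} (hG : ∀ n, GaussianPositive V (G n)) {g : ℝ → ℝ}
    (hg : Measurable g) {C : ℝ} (hC : ∀ n r, 0 ≤ r → |G n r| ≤ C)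
    (hlim : ∀ r, 0 ≤ r → Tendsto (fun n => G n r) atTop (𝓝 (g r))) : GaussianPositive V g := by
  refine ⟨hg, ⟨C, fun r hr => le_of_tendsto (hlim r hr).abs (Eventually.of_forall fun n =>
    hC n r hr)⟩, fun ε hε x => ?_⟩
  refine ge_of_tendsto (tendsto_integral_of_dominated_convergence
    (fun ξ : V => C * Real.exp (-(ε * ‖ξ‖ ^ 2))) (fun n => ((hG n).integrable hε x).1)
    ((integrable_exp_neg_mul_norm_sq hε).const_mul C) (fun n => ae_of_all _ fun ξ => ?_)
    (ae_of_all _ fun ξ => (hlim _ (by positivity)).mul_const _))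
    (Eventually.of_forall fun n => (hG n).nonneg ε hε x)
  rw [norm_mul, norm_mul, Real.norm_eq_abs, Real.norm_eq_abs, Real.norm_eq_abs, Real.abs_exp]
  have h1 := hC n (‖ξ‖ ^ 2) (by positivity)
  exact mul_le_mul h1 (mul_le_of_le_one_right (Real.exp_pos _).le (Real.abs_cos_le_one _))
    (by positivity) ((abs_nonneg _).trans h1)

/-- By Fubini the regularised transform is a positive superposition of those handled by `exp_mul`.
-/
lemma mixture_mul {g : ℝ → ℝ} (hg : GaussianPositive V g) {k : ℝ → ℝ} {δ : ℝ} (hδ : 0 ≤ δ)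
    (hk : IntegrableOn k (Ioi δ)) (hk0 : ∀ s ∈ Ioi δ, 0 ≤ k s) :
    GaussianPositive V fun r => (∫ s in Ioi δ, Real.exp (-(s * r)) * k s) * g r := by
  obtain ⟨B, hB⟩ := hg.bounded
  have hgm := hg.measurable
  have hle : ∀ s ∈ Ioi δ, ∀ r, 0 ≤ r → Real.exp (-(s * r)) ≤ 1 := fun s hs r hr =>
    Real.exp_le_one_iff.2 (by have := mul_nonneg (hδ.trans (mem_Ioi.1 hs).le) hr; linarith)
  refine ⟨?_, ⟨(∫ s in Ioi δ, k s) * B, fun r hr => ?_⟩, fun ε hε x => ?_⟩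
  · refine Measurable.mul ?_ hgm
    -- The density is known to be measurable only almost everywhere; a measurable representative
    -- makes the integral a measurable function of `r`.
    obtain ⟨k', hk'm, hk'⟩ := hk.aestronglyMeasurable
    have : (fun r => ∫ s in Ioi δ, Real.exp (-(s * r)) * k s)
        = fun r => ∫ s in Ioi δ, Real.exp (-(s * r)) * k' s := by
      ext r
      refine integral_congr_ae ?_
      filter_upwards [hk'] with s hs
      rw [hs]
    rw [this]
    refine (StronglyMeasurable.integral_prod_right (f := fun r s => Real.exp (-(s * r)) * k' s)
      ?_).measurable
    have := hk'm.measurable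
    exact Measurable.stronglyMeasurable (by unfold Function.uncurry; fun_prop)
  · rw [abs_mul]
    refine mul_le_mul ?_ (hB r hr) (abs_nonneg _) (setIntegral_nonneg measurableSet_Ioi hk0)
    refine norm_integral_le_of_norm_le hk (f := fun s => Real.exp (-(s * r)) * k s) ?_
    filter_upwards [ae_restrict_mem measurableSet_Ioi] with s hs
    rw [norm_mul, Real.norm_eq_abs, Real.norm_eq_abs, Real.abs_exp, abs_of_nonneg (hk0 s hs)]
    exact mul_le_of_le_one_left (hk0 s hs) (hle s hs r hr)
  · have hint : Integrable (Function.uncurry fun (ξ : V) (s : ℝ) =>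
        k s * (Real.exp (-(s * ‖ξ‖ ^ 2)) * g (‖ξ‖ ^ 2) *
          (Real.exp (-(ε * ‖ξ‖ ^ 2)) * Real.cos (2 * Real.pi * inner ℝ ξ x))))
        (volume.prod (volume.restrict (Ioi δ))) := by
      refine ((hg.integrable hε x).norm.mul_prod hk.norm).mono' ?_ ?_
      · refine AEStronglyMeasurable.mul hk.aestronglyMeasurable.comp_snd ?_
        exact Measurable.aestronglyMeasurable (by fun_prop)
      · have : ∀ᵐ z : V × ℝ ∂(volume.prod (volume.restrict (Ioi δ))), z.2 ∈ Ioi δ :=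
          Measure.quasiMeasurePreserving_snd.ae (ae_restrict_mem measurableSet_Ioi)
        filter_upwards [this] with z hz
        simp only [Function.uncurry]
        rw [norm_mul, mul_assoc, norm_mul (Real.exp _), Real.norm_eq_abs (Real.exp _),
          Real.abs_exp, mul_comm]
        exact mul_le_mul_of_nonneg_right
          (mul_le_of_le_one_left (norm_nonneg _) (hle _ hz _ (by positivity))) (norm_nonneg _)
    have : ∫ ξ : V, (∫ s in Ioi δ, Real.exp (-(s * ‖ξ‖ ^ 2)) * k s) * g (‖ξ‖ ^ 2) *
        (Real.exp (-(ε * ‖ξ‖ ^ 2)) * Real.cos (2 * Real.pi * inner ℝ ξ x))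
        = ∫ s in Ioi δ, ∫ ξ : V, k s * (Real.exp (-(s * ‖ξ‖ ^ 2)) * g (‖ξ‖ ^ 2) *
          (Real.exp (-(ε * ‖ξ‖ ^ 2)) * Real.cos (2 * Real.pi * inner ℝ ξ x))) := by
      rw [← integral_integral_swap hint]
      congr 1
      ext ξ
      rw [mul_assoc, ← integral_mul_const]
      congr 1
      ext s
      ring
    rw [this]
    refine setIntegral_nonneg measurableSet_Ioi fun s hs => ?_
    rw [integral_const_mul]
    exact mul_nonneg (hk0 s hs) ((hg.exp_mul (hδ.trans (mem_Ioi.1 hs).le)).nonneg ε hε x)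

/-- With `h` the mixture, `e^h = lim (1 + h/n)^n`. Each power is reached by repeated multiplication
by `h`, so `mixture_mul` suffices and closure under general products is never needed. -/
lemma exp_mixture {k : ℝ → ℝ} {δ : ℝ} (hδ : 0 ≤ δ)
    (hk : IntegrableOn k (Ioi δ)) (hk0 : ∀ s ∈ Ioi δ, 0 ≤ k s) :
    GaussianPositive V fun r => Real.exp (∫ s in Ioi δ, Real.exp (-(s * r)) * k s) := by
  set h : ℝ → ℝ := fun r => ∫ s in Ioi δ, Real.exp (-(s * r)) * k s with hh
  have hh1 : GaussianPositive V h := by simpa using one.mixture_mul (V := V) hδ hk hk0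
  have hh0 : ∀ r, 0 ≤ h r := fun r => setIntegral_nonneg measurableSet_Ioi fun s hs =>
    mul_nonneg (Real.exp_pos _).le (hk0 s hs)
  have hpow : ∀ c : ℝ, 0 ≤ c → ∀ n : ℕ, GaussianPositive V fun r => (1 + c * h r) ^ n := by
    intro c hc n
    induction n with
    | zero => simpa using one (V := V)
    | succ n ih =>
      convert ih.add ((ih.mixture_mul hδ hk hk0).const_mul hc) using 2 with r
      rw [pow_succ]
      ring
  obtain ⟨C, hC⟩ := hh1.bounded
  refine of_tendsto (G := fun n r => (1 + (1 / n : ℝ) * h r) ^ n) (C := Real.exp C)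
    (fun n => hpow _ (by positivity) n) (Real.measurable_exp.comp hh1.measurable)
    (fun n r hr => ?_) (fun r _ => ?_)
  · have h0 : 0 ≤ (1 / n : ℝ) * h r := mul_nonneg (by positivity) (hh0 r)
    rw [abs_of_nonneg (by positivity)]
    calc (1 + (1 / n : ℝ) * h r) ^ n ≤ (Real.exp ((1 / n : ℝ) * h r)) ^ n :=
          pow_le_pow_left₀ (by positivity) (by rw [add_comm]; exact Real.add_one_le_exp _) _
      _ = Real.exp (n * ((1 / n : ℝ) * h r)) := (Real.exp_nat_mul _ _).symm
      _ ≤ Real.exp C := by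
          refine Real.exp_le_exp.2 (le_trans ?_ ((le_abs_self _).trans (hC r hr)))
          rw [← mul_assoc]
          refine mul_le_of_le_one_left (hh0 r) ?_
          -- At `n = 0` the convention `1 / 0 = 0` makes the factor `n * (1 / n)` equal to `0`;
          -- otherwise it is `1`.
          rcases eq_or_ne n 0 with rfl | hn
          · simp
          · field_simp; rfl
  · simpa [div_eq_inv_mul] using Real.tendsto_one_add_div_pow_exp (h r)

end GaussianPositive

end GaussianPositivity

/-! ### Subordination: the Lévy representation of `r ^ β` -/

section FractionalPower

/-- The Lévy density integral `∫ (1 - e^{-s}) s^{-1-β} ds` converges for `0 < β < 1`. -/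
lemma integrableOn_one_sub_exp_mul_rpow {β r : ℝ} (hβ : 0 < β) (hβ1 : β < 1) (hr : 0 ≤ r) :
    IntegrableOn (fun s : ℝ => (1 - Real.exp (-(s * r))) * s ^ (-1 - β)) (Ioi 0) := by
  have hmeas : Measurable fun s : ℝ => (1 - Real.exp (-(s * r))) * s ^ (-1 - β) := by fun_prop
  rw [← Ioc_union_Ioi_eq_Ioi zero_le_one]
  refine IntegrableOn.union ?_ ?_
  · have h : IntegrableOn (fun s : ℝ => r * s ^ (-β)) (Ioc 0 1) := by
      have := (intervalIntegral.intervalIntegrable_rpow' (a := 0) (b := 1) (r := -β)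
        (by linarith)).const_mul r
      rwa [intervalIntegrable_iff_integrableOn_Ioc_of_le zero_le_one] at this
    refine h.mono' hmeas.aestronglyMeasurable ?_
    filter_upwards [ae_restrict_mem measurableSet_Ioc] with s hs
    have h1 : 0 ≤ 1 - Real.exp (-(s * r)) := by
      have : Real.exp (-(s * r)) ≤ 1 :=
        Real.exp_le_one_iff.2 (by have := mul_nonneg hs.1.le hr; linarith)
      linarith
    have h2 : 1 - Real.exp (-(s * r)) ≤ s * r := by
      have := Real.add_one_le_exp (-(s * r)); linarith
    have h3 : 0 ≤ s ^ (-1 - β) := Real.rpow_nonneg hs.1.le _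
    rw [norm_mul, Real.norm_of_nonneg h1, Real.norm_of_nonneg h3]
    calc (1 - Real.exp (-(s * r))) * s ^ (-1 - β) ≤ s * r * s ^ (-1 - β) :=
          mul_le_mul_of_nonneg_right h2 h3
      _ = r * (s ^ (1 : ℝ) * s ^ (-1 - β)) := by rw [Real.rpow_one]; ring
      _ = r * s ^ (-β) := by rw [← Real.rpow_add hs.1]; congr 2; ring
  · refine (integrableOn_Ioi_rpow_of_lt (a := -1 - β) (by linarith) zero_lt_one).mono'
      hmeas.aestronglyMeasurable ?_
    filter_upwards [ae_restrict_mem measurableSet_Ioi] with s hs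
    have hs0 : 0 < s := zero_lt_one.trans (mem_Ioi.1 hs)
    have h1 : 0 ≤ 1 - Real.exp (-(s * r)) := by
      have : Real.exp (-(s * r)) ≤ 1 :=
        Real.exp_le_one_iff.2 (by have := mul_nonneg hs0.le hr; linarith)
      linarith
    have h3 : 0 ≤ s ^ (-1 - β) := Real.rpow_nonneg hs0.le _
    rw [norm_mul, Real.norm_of_nonneg h1, Real.norm_of_nonneg h3]
    exact mul_le_of_le_one_left h3 (by have := Real.exp_pos (-(s * r)); linarith)

/-- The constant is the integral at `r = 1`; the substitution `s ↦ r s` gives the homogeneity. -/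
lemma exists_integral_one_sub_exp_mul_rpow {β : ℝ} (hβ : 0 < β) (hβ1 : β < 1) :
    ∃ c : ℝ, 0 < c ∧ ∀ r : ℝ, 0 ≤ r →
      ∫ s in Ioi (0 : ℝ), (1 - Real.exp (-(s * r))) * s ^ (-1 - β) = c * r ^ β := by
  refine ⟨∫ s in Ioi (0 : ℝ), (1 - Real.exp (-(s * 1))) * s ^ (-1 - β), ?_, fun r hr => ?_⟩
  · have hint := integrableOn_one_sub_exp_mul_rpow hβ hβ1 zero_le_one
    have hpos : ∀ s ∈ Ioi (0 : ℝ), 0 < (1 - Real.exp (-(s * 1))) * s ^ (-1 - β) := by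
      intro s hs
      have hs : 0 < s := hs
      refine mul_pos ?_ (Real.rpow_pos_of_pos hs _)
      have : Real.exp (-(s * 1)) < 1 := (Real.exp_lt_exp.2 (by linarith)).trans_eq Real.exp_zero
      linarith
    rw [setIntegral_pos_iff_support_of_nonneg_ae _ hint]
    · have : Ioi (0 : ℝ) ⊆ Function.support
          (fun s : ℝ => (1 - Real.exp (-(s * 1))) * s ^ (-1 - β)) ∩ Ioi 0 :=
        fun s hs => ⟨(hpos s hs).ne', hs⟩
      exact lt_of_lt_of_le (by simp) (measure_mono this)
    · filter_upwards [ae_restrict_mem measurableSet_Ioi] with s hs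
      exact (hpos s hs).le
  · rcases hr.eq_or_lt with rfl | hr
    · simp [Real.zero_rpow hβ.ne']
    · have h := integral_comp_mul_left_Ioi
        (fun s : ℝ => (1 - Real.exp (-(s * 1))) * s ^ (-1 - β)) 0 hr
      rw [mul_zero] at h
      have h2 : ∫ s in Ioi (0 : ℝ), (1 - Real.exp (-(r * s * 1))) * (r * s) ^ (-1 - β)
          = r ^ (-1 - β) * ∫ s in Ioi (0 : ℝ), (1 - Real.exp (-(s * r))) * s ^ (-1 - β) := by
        rw [← integral_const_mul]
        refine setIntegral_congr_fun measurableSet_Ioi fun s hs => ?_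
        rw [Real.mul_rpow hr.le (mem_Ioi.1 hs).le, mul_one, mul_comm r s]
        ring
      rw [h2, smul_eq_mul] at h
      have hrβ : r ^ (-1 - β) ≠ 0 := (Real.rpow_pos_of_pos hr _).ne'
      apply mul_left_cancel₀ hrβ
      rw [h]
      have : r⁻¹ = r ^ (-1 - β) * r ^ β := by
        rw [← Real.rpow_add hr, ← Real.rpow_neg_one]; congr 1; ring
      rw [this]; ring

variable {V : Type*} [NormedAddCommGroup V] [InnerProductSpace ℝ V] [FiniteDimensional ℝ V]
  [MeasurableSpace V] [BorelSpace V]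

/-- Cutting the Lévy density off below `δ` makes its mass finite. Then `exp (-∫ (1 - e^{-sr}) k)`
splits into the constant `exp (-∫ k)` times the exponential of a mixture, covered by `exp_mixture`;
finally `δ → 0`. -/
lemma GaussianPositive.exp_neg_rpow {β : ℝ} (hβ : 0 < β) (hβ1 : β ≤ 1) {t : ℝ} (ht : 0 ≤ t) :
    GaussianPositive V fun r => Real.exp (-(t * r ^ β)) := by
  -- At `β = 1` the profile is itself a Gaussian in `ξ`, while the Lévy integral diverges at `0`.
  rcases hβ1.eq_or_lt with rfl | hβ1
  · simpa using (one (V := V)).exp_mul ht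
  obtain ⟨c, hc, hcr⟩ := exists_integral_one_sub_exp_mul_rpow hβ hβ1
  set τ := t / c with hτ
  have hτ0 : 0 ≤ τ := div_nonneg ht hc.le
  set δ : ℕ → ℝ := fun n => 1 / ((n : ℝ) + 1) with hδ
  have hδ0 : ∀ n, 0 < δ n := fun n => by positivity
  have hk0 : ∀ n, ∀ s ∈ Ioi (δ n), 0 ≤ τ * s ^ (-1 - β) := fun n s hs =>
    mul_nonneg hτ0 (Real.rpow_nonneg ((hδ0 n).trans (mem_Ioi.1 hs)).le _)
  have hk : ∀ n, IntegrableOn (fun s : ℝ => τ * s ^ (-1 - β)) (Ioi (δ n)) := fun n =>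
    (integrableOn_Ioi_rpow_of_lt (a := -1 - β) (by linarith) (hδ0 n)).const_mul τ
  have hkexp : ∀ n r, 0 ≤ r →
      IntegrableOn (fun s : ℝ => Real.exp (-(s * r)) * (τ * s ^ (-1 - β))) (Ioi (δ n)) := by
    intro n r hr
    refine (hk n).mono' (by fun_prop) ?_
    filter_upwards [ae_restrict_mem measurableSet_Ioi] with s hs
    rw [norm_mul, Real.norm_eq_abs, Real.abs_exp, Real.norm_of_nonneg (hk0 n s hs)]
    refine mul_le_of_le_one_left (hk0 n s hs) (Real.exp_le_one_iff.2 ?_)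
    have := mul_nonneg ((hδ0 n).trans (mem_Ioi.1 hs)).le hr
    linarith
  have key : ∀ n r, 0 ≤ r → Real.exp (-∫ s in Ioi (δ n), τ * s ^ (-1 - β)) *
      Real.exp (∫ s in Ioi (δ n), Real.exp (-(s * r)) * (τ * s ^ (-1 - β)))
      = Real.exp (-(τ * ∫ s in Ioi (δ n), (1 - Real.exp (-(s * r))) * s ^ (-1 - β))) := by
    intro n r hr
    rw [← Real.exp_add, ← integral_const_mul, neg_add_eq_sub, ← neg_sub, ← integral_sub (hk n)
      (hkexp n r hr)]
    congr 3
    ext s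
    ring
  have hnn : ∀ n r, 0 ≤ r →
      0 ≤ ∫ s in Ioi (δ n), (1 - Real.exp (-(s * r))) * s ^ (-1 - β) := by
    intro n r hr
    refine setIntegral_nonneg measurableSet_Ioi fun s hs => ?_
    have hs0 := (hδ0 n).trans (mem_Ioi.1 hs)
    refine mul_nonneg ?_ (Real.rpow_nonneg hs0.le _)
    have : Real.exp (-(s * r)) ≤ 1 :=
      Real.exp_le_one_iff.2 (by have := mul_nonneg hs0.le hr; linarith)
    linarith
  refine of_tendsto (C := 1) (fun n => (exp_mixture (V := V) (hδ0 n).le (hk n) (hk0 n)).const_mul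
    (Real.exp_pos (-∫ s in Ioi (δ n), τ * s ^ (-1 - β))).le) (by fun_prop) (fun n r hr => ?_)
    (fun r hr => ?_)
  · rw [key n r hr, Real.abs_exp]
    exact Real.exp_le_one_iff.2 (neg_nonpos.2 (mul_nonneg hτ0 (hnn n r hr)))
  · simp_rw [key _ r hr]
    have hlim : Tendsto (fun n => ∫ s in Ioi (δ n), (1 - Real.exp (-(s * r))) * s ^ (-1 - β))
        atTop (𝓝 (c * r ^ β)) := by
      rw [← hcr r hr]
      have hU : (⋃ n, Ioi (δ n)) = Ioi (0 : ℝ) := by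
        ext s
        simp only [mem_iUnion, mem_Ioi]
        refine ⟨fun ⟨n, hn⟩ => (hδ0 n).trans hn, fun hs => exists_nat_one_div_lt hs⟩
      have := tendsto_setIntegral_of_monotone (μ := volume) (s := fun n => Ioi (δ n))
        (f := fun s : ℝ => (1 - Real.exp (-(s * r))) * s ^ (-1 - β))
        (fun n => measurableSet_Ioi)
        (fun m n hmn => Ioi_subset_Ioi (by
          simp only [hδ]
          exact one_div_le_one_div_of_le (by positivity) (by gcongr)))
        (by rw [hU]; exact integrableOn_one_sub_exp_mul_rpow hβ hβ1 hr)
      rwa [hU] at this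
    have e : t * r ^ β = τ * (c * r ^ β) := by rw [hτ]; field_simp
    rw [e]
    exact (Real.continuous_exp.tendsto _).comp ((hlim.const_mul τ).neg)

end FractionalPower

/-! ### The symbol `(2π‖ξ‖)^α` and its exponential -/

section StableSymbol

variable {V : Type*} [NormedAddCommGroup V]

/-- The Fourier symbol `(2π‖ξ‖)^α` of the fractional Laplacian, in Mathlib's normalisation. -/
noncomputable def stableSymbol (α : ℝ) (ξ : V) : ℝ := (2 * Real.pi * ‖ξ‖) ^ α

lemma stableSymbol_nonneg (α : ℝ) (ξ : V) : 0 ≤ stableSymbol α ξ :=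
  Real.rpow_nonneg (by positivity) _

lemma stableSymbol_zero {α : ℝ} (hα : 0 < α) : stableSymbol α (0 : V) = 0 := by
  simp [stableSymbol, Real.zero_rpow hα.ne']

@[simp] lemma stableSymbol_neg (α : ℝ) (ξ : V) : stableSymbol α (-ξ) = stableSymbol α ξ := by
  simp [stableSymbol]

lemma stableSymbol_smul [NormedSpace ℝ V] (α : ℝ) {c : ℝ} (hc : 0 ≤ c) (ξ : V) :
    stableSymbol α (c • ξ) = c ^ α * stableSymbol α ξ := by
  rw [stableSymbol, stableSymbol, norm_smul, Real.norm_of_nonneg hc,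
    ← Real.mul_rpow hc (by positivity)]
  congr 1
  ring

lemma continuous_stableSymbol {α : ℝ} (hα : 0 ≤ α) : Continuous (stableSymbol α : V → ℝ) := by
  unfold stableSymbol
  exact Continuous.rpow_const (by fun_prop) fun _ => Or.inr hα

lemma stableSymbol_eq_norm_sq_rpow (α : ℝ) (ξ : V) :
    stableSymbol α ξ = (2 * Real.pi) ^ α * (‖ξ‖ ^ 2) ^ (α / 2) := by
  rw [stableSymbol, Real.mul_rpow (by positivity) (by positivity), ← Real.rpow_natCast,
    ← Real.rpow_mul (norm_nonneg _)]
  congr 2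
  push_cast
  ring

lemma exp_neg_mul_stableSymbol_le_one (α : ℝ) {t : ℝ} (ht : 0 ≤ t) (ξ : V) :
    Real.exp (-(t * stableSymbol α ξ)) ≤ 1 :=
  Real.exp_le_one_iff.2 (neg_nonpos.2 (mul_nonneg ht (stableSymbol_nonneg _ _)))

variable [InnerProductSpace ℝ V] [FiniteDimensional ℝ V] [MeasurableSpace V] [BorelSpace V]

lemma integrable_exp_neg_stableSymbol {α : ℝ} (hα : 0 < α) {t : ℝ} (ht : 0 < t) :
    Integrable fun ξ : V => Real.exp (-(t * stableSymbol α ξ)) := by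
  -- Any exponent above the dimension makes `(1 + ‖ξ‖)^{-d}` integrable; the exponential decays
  -- faster than this.
  set d : ℝ := Module.finrank ℝ V + 1 with hd
  have hd0 : 0 < d := by positivity
  have hdec : Tendsto (fun s : ℝ => s ^ (d / α) * Real.exp (-t * s)) atTop (𝓝 0) :=
    tendsto_rpow_mul_exp_neg_mul_atTop_nhds_zero _ _ ht
  have hcont : Continuous fun r : ℝ =>
      (1 + |r|) ^ d * Real.exp (-(t * (2 * Real.pi * |r|) ^ α)) := by
    refine Continuous.mul (Continuous.rpow_const (by fun_prop) fun _ => Or.inr hd0.le) ?_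
    refine Real.continuous_exp.comp (Continuous.neg (continuous_const.mul
      (Continuous.rpow_const (by fun_prop) fun _ => Or.inr hα.le)))
  have hlim : Tendsto (fun r : ℝ => (1 + |r|) ^ d * Real.exp (-(t * (2 * Real.pi * |r|) ^ α)))
      atTop (𝓝 0) := by
    have h2 := hdec.comp ((tendsto_rpow_atTop hα).comp
      (Tendsto.const_mul_atTop (show 0 < 2 * Real.pi by positivity) tendsto_id))
    refine squeeze_zero' (Eventually.of_forall fun r => by positivity) ?_ h2
    filter_upwards [eventually_ge_atTop 1] with r hr
    have hr0 : 0 ≤ r := by linarith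
    have hpi := Real.pi_gt_three
    simp only [Function.comp, id, abs_of_nonneg hr0, neg_mul]
    rw [← Real.rpow_mul (by positivity), mul_div_cancel₀ _ hα.ne']
    refine mul_le_mul_of_nonneg_right (Real.rpow_le_rpow (by positivity) ?_ hd0.le)
      (Real.exp_pos _).le
    nlinarith
  have hbdd : ∃ C, ∀ r : ℝ, 0 ≤ r → (1 + r) ^ d * Real.exp (-(t * (2 * Real.pi * r) ^ α)) ≤ C := by
    obtain ⟨R, hR⟩ := (hlim.eventually_le_const zero_lt_one).exists_forall_of_atTop
    obtain ⟨C, hC⟩ := (isCompact_Icc (a := (0 : ℝ)) (b := R)).bddAbove_image hcont.continuousOn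
    refine ⟨max C 1, fun r hr => ?_⟩
    rcases le_total r R with h | h
    · have := hC ⟨r, ⟨hr, h⟩, rfl⟩
      simp only [abs_of_nonneg hr] at this
      exact this.trans (le_max_left _ _)
    · have := hR r h
      simp only [abs_of_nonneg hr] at this
      exact this.trans (le_max_right _ _)
  obtain ⟨C, hC⟩ := hbdd
  refine ((integrable_one_add_norm (E := V) (μ := volume) (r := d) (by linarith)).const_mul
    C).mono' ?_ (ae_of_all _ fun ξ => ?_)
  · have := continuous_stableSymbol (V := V) hα.le
    exact Continuous.aestronglyMeasurable (by fun_prop)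
  · rw [Real.norm_eq_abs, Real.abs_exp, Real.rpow_neg (by positivity), ← div_eq_mul_inv,
      le_div_iff₀ (by positivity), mul_comm]
    exact hC _ (norm_nonneg ξ)

/-- In the variable `r = ‖ξ‖²` the exponential has profile `exp (-t (2π)^α r^{α/2})`. Being
integrable in `ξ`, it needs no regularisation, and `ε → 0` by dominated convergence. -/
lemma integral_exp_neg_stableSymbol_mul_cos_nonneg {α : ℝ} (hα : 0 < α) (hα2 : α ≤ 2) {t : ℝ}
    (ht : 0 < t) (x : V) :
    0 ≤ ∫ ξ : V, Real.exp (-(t * stableSymbol α ξ)) * Real.cos (2 * Real.pi * inner ℝ ξ x) := by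
  have hG := GaussianPositive.exp_neg_rpow (V := V) (β := α / 2) (by linarith) (by linarith)
    (t := t * (2 * Real.pi) ^ α) (by positivity)
  have hprof : ∀ ξ : V, Real.exp (-(t * (2 * Real.pi) ^ α * (‖ξ‖ ^ 2) ^ (α / 2)))
      = Real.exp (-(t * stableSymbol α ξ)) := fun ξ => by
    rw [stableSymbol_eq_norm_sq_rpow, mul_assoc]
  have hlim : Tendsto (fun n : ℕ => ∫ ξ : V, Real.exp (-(t * stableSymbol α ξ)) *
      (Real.exp (-(1 / ((n : ℝ) + 1) * ‖ξ‖ ^ 2)) * Real.cos (2 * Real.pi * inner ℝ ξ x))) atTop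
      (𝓝 (∫ ξ : V, Real.exp (-(t * stableSymbol α ξ)) *
        (1 * Real.cos (2 * Real.pi * inner ℝ ξ x)))) := by
    refine tendsto_integral_of_dominated_convergence _ (fun n => ?_)
      (integrable_exp_neg_stableSymbol hα ht) (fun n => ae_of_all _ fun ξ => ?_)
      (ae_of_all _ fun ξ => ?_)
    · have := continuous_stableSymbol (V := V) hα.le
      exact Continuous.aestronglyMeasurable (by fun_prop)
    · rw [norm_mul, norm_mul, Real.norm_eq_abs, Real.norm_eq_abs, Real.abs_exp, Real.abs_exp]
      refine mul_le_of_le_one_right (Real.exp_pos _).le (mul_le_one₀ ?_ (norm_nonneg _)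
        (Real.abs_cos_le_one _))
      exact Real.exp_le_one_iff.2 (neg_nonpos.2 (by positivity))
    · refine Tendsto.const_mul _ (Tendsto.mul_const _ ?_)
      have h : Tendsto (fun n : ℕ => -(1 / ((n : ℝ) + 1) * ‖ξ‖ ^ 2)) atTop (𝓝 0) := by
        simpa using (tendsto_one_div_add_atTop_nhds_zero_nat.mul_const (‖ξ‖ ^ 2)).neg
      simpa [Function.comp_def] using (Real.continuous_exp.tendsto _).comp h
  simp only [one_mul] at hlim
  refine ge_of_tendsto hlim (Eventually.of_forall fun n => ?_)
  have := hG.nonneg (1 / ((n : ℝ) + 1)) (by positivity) x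
  simpa only [hprof] using this

end StableSymbol

/-! ### Fatou's lemma and the Fourier multiplication formula -/

section Auxiliary

/-- This is Fatou's lemma with integrability of the limit as part of the conclusion; it turns
uniform bounds into integrability of `fundSol` and of `u ^ p` on all of space. -/
lemma integrable_and_integral_le_of_tendsto {X : Type*} [MeasurableSpace X] {μ : Measure X}
    {F : ℕ → X → ℝ} {f : X → ℝ} {C : ℝ} (hF : ∀ n, Integrable (F n) μ)
    (hF0 : ∀ n, ∀ᵐ x ∂μ, 0 ≤ F n x) (hC : ∀ n, ∫ x, F n x ∂μ ≤ C)
    (hlim : ∀ᵐ x ∂μ, Tendsto (fun n => F n x) atTop (𝓝 (f x))) :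
    Integrable f μ ∧ ∫ x, f x ∂μ ≤ C := by
  have hfm : AEStronglyMeasurable f μ :=
    aestronglyMeasurable_of_tendsto_ae _ (fun n => (hF n).1) hlim
  have hf0 : ∀ᵐ x ∂μ, 0 ≤ f x := by
    filter_upwards [hlim, ae_all_iff.2 hF0] with x hx h0
    exact ge_of_tendsto hx (Eventually.of_forall h0)
  have hC0 : 0 ≤ C := (integral_nonneg_of_ae (hF0 0)).trans (hC 0)
  have hle : ∫⁻ x, ENNReal.ofReal (f x) ∂μ ≤ ENNReal.ofReal C := by
    calc ∫⁻ x, ENNReal.ofReal (f x) ∂μ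
        = ∫⁻ x, liminf (fun n => ENNReal.ofReal (F n x)) atTop ∂μ := by
          refine lintegral_congr_ae ?_
          filter_upwards [hlim] with x hx
          exact ((ENNReal.continuous_ofReal.tendsto _).comp hx).liminf_eq.symm
      _ ≤ liminf (fun n => ∫⁻ x, ENNReal.ofReal (F n x) ∂μ) atTop :=
          lintegral_liminf_le' fun n => (hF n).1.aemeasurable.ennreal_ofReal
      _ ≤ ENNReal.ofReal C := by
          refine liminf_le_of_le (by isBoundedDefault) fun b hb => ?_
          obtain ⟨n, hn⟩ := hb.exists
          refine hn.trans ?_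
          rw [← ofReal_integral_eq_lintegral_ofReal (hF n) (hF0 n)]
          exact ENNReal.ofReal_le_ofReal (hC n)
  have hint : Integrable f μ := by
    refine ⟨hfm, ?_⟩
    rw [hasFiniteIntegral_iff_ofReal hf0]
    exact hle.trans_lt ENNReal.ofReal_lt_top
  refine ⟨hint, ?_⟩
  rw [← ofReal_integral_eq_lintegral_ofReal hint hf0] at hle
  exact (ENNReal.ofReal_le_ofReal_iff hC0).1 hle

lemma integral_fourier_mul_eq_of_integrable {V : Type*} [NormedAddCommGroup V]
    [InnerProductSpace ℝ V] [FiniteDimensional ℝ V] [MeasurableSpace V] [BorelSpace V]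
    {f g : V → ℂ} (hf : Integrable f) (hg : Integrable g) :
    ∫ ξ, 𝓕 f ξ * g ξ = ∫ x, f x * 𝓕 g x := by
  simpa using! VectorFourier.integral_bilin_fourierIntegral_eq_flip (ContinuousLinearMap.mul ℂ ℂ)
    (L := innerₗ V) Real.continuous_fourierChar continuous_inner hf hg

end Auxiliary

/-! ### The fundamental solution: positivity, scaling, unit mass -/

section HeatKernel

variable {N : ℕ} {α : ℝ}

lemma fourierInv_exp_neg_stableSymbol (hα : 0 < α) {t : ℝ} (ht : 0 < t)
    (x : EuclideanSpace ℝ (Fin N)) :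
    𝓕⁻ (fun ξ : EuclideanSpace ℝ (Fin N) => ((Real.exp (-(t * stableSymbol α ξ)) : ℝ) : ℂ)) x
      = ((∫ ξ, Real.exp (-(t * stableSymbol α ξ)) * Real.cos (2 * Real.pi * inner ℝ ξ x) : ℝ) : ℂ)
      := by
  have hi := integrable_exp_neg_stableSymbol (V := EuclideanSpace ℝ (Fin N)) hα ht
  have hc := continuous_stableSymbol (V := EuclideanSpace ℝ (Fin N)) hα.le
  have h1 : Integrable fun ξ : EuclideanSpace ℝ (Fin N) =>
      Real.exp (-(t * stableSymbol α ξ)) * Real.cos (2 * Real.pi * inner ℝ ξ x) :=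
    hi.mul_bdd (c := 1) (Continuous.aestronglyMeasurable (by fun_prop))
      (ae_of_all _ fun ξ => Real.abs_cos_le_one _)
  have h2 : Integrable fun ξ : EuclideanSpace ℝ (Fin N) =>
      Real.exp (-(t * stableSymbol α ξ)) * Real.sin (2 * Real.pi * inner ℝ ξ x) :=
    hi.mul_bdd (c := 1) (Continuous.aestronglyMeasurable (by fun_prop))
      (ae_of_all _ fun ξ => Real.abs_sin_le_one _)
  -- The sine part of the integrand is odd in `ξ`.
  have h3 : ∫ ξ : EuclideanSpace ℝ (Fin N),
      Real.exp (-(t * stableSymbol α ξ)) * Real.sin (2 * Real.pi * inner ℝ ξ x) = 0 := by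
    have := integral_neg_eq_self (μ := volume) (fun ξ : EuclideanSpace ℝ (Fin N) =>
      Real.exp (-(t * stableSymbol α ξ)) * Real.sin (2 * Real.pi * inner ℝ ξ x))
    simp only [stableSymbol_neg, inner_neg_left, mul_neg, Real.sin_neg, integral_neg] at this
    linarith
  have h4 : ∀ ξ : EuclideanSpace ℝ (Fin N),
      Complex.exp ((↑(2 * Real.pi * inner ℝ ξ x) * Complex.I)) •
        ((Real.exp (-(t * stableSymbol α ξ)) : ℝ) : ℂ)
      = ((Real.exp (-(t * stableSymbol α ξ)) * Real.cos (2 * Real.pi * inner ℝ ξ x) : ℝ) : ℂ)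
        + ((Real.exp (-(t * stableSymbol α ξ)) * Real.sin (2 * Real.pi * inner ℝ ξ x) : ℝ) : ℂ)
          * Complex.I := by
    intro ξ
    rw [Complex.exp_mul_I, ← Complex.ofReal_cos, ← Complex.ofReal_sin, smul_eq_mul]
    push_cast
    ring
  rw [Real.fourierInv_eq']
  simp_rw [h4]
  rw [integral_add h1.ofReal (h2.ofReal.mul_const _), integral_mul_const, integral_complex_ofReal,
    integral_complex_ofReal, h3]
  simp

lemma fundSol_eq_integral (hα : 0 < α) {t : ℝ} (ht : 0 < t) (x : EuclideanSpace ℝ (Fin N)) :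
    fundSol α t x
      = ∫ ξ, Real.exp (-(t * stableSymbol α ξ)) * Real.cos (2 * Real.pi * inner ℝ ξ x) := by
  have h := congrArg Complex.re (fourierInv_exp_neg_stableSymbol hα ht x)
  rwa [Complex.ofReal_re] at h

lemma fourierInv_eq_fundSol (hα : 0 < α) {t : ℝ} (ht : 0 < t) :
    𝓕⁻ (fun ξ : EuclideanSpace ℝ (Fin N) => ((Real.exp (-(t * stableSymbol α ξ)) : ℝ) : ℂ))
      = fun x => (fundSol α t x : ℂ) := by
  ext x
  rw [fundSol_eq_integral hα ht, fourierInv_exp_neg_stableSymbol hα ht]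

lemma fundSol_nonneg (hα : 0 < α) (hα2 : α ≤ 2) {t : ℝ} (ht : 0 < t)
    (x : EuclideanSpace ℝ (Fin N)) : 0 ≤ fundSol α t x := by
  rw [fundSol_eq_integral hα ht]
  exact integral_exp_neg_stableSymbol_mul_cos_nonneg hα hα2 ht x

lemma fundSol_le (hα : 0 < α) {t : ℝ} (ht : 0 < t) (x : EuclideanSpace ℝ (Fin N)) :
    fundSol α t x ≤ fundSol α t (0 : EuclideanSpace ℝ (Fin N)) := by
  rw [fundSol_eq_integral hα ht, fundSol_eq_integral hα ht]
  have hi := integrable_exp_neg_stableSymbol (V := EuclideanSpace ℝ (Fin N)) hα ht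
  simp only [inner_zero_right, mul_zero, Real.cos_zero, mul_one]
  have hc := continuous_stableSymbol (V := EuclideanSpace ℝ (Fin N)) hα.le
  refine integral_mono (hi.mul_bdd (c := 1) (Continuous.aestronglyMeasurable (by fun_prop))
    (ae_of_all _ fun ξ => Real.abs_cos_le_one _)) hi fun ξ => ?_
  exact mul_le_of_le_one_right (Real.exp_pos _).le (Real.cos_le_one _)

lemma fundSol_scaling (hα : 0 < α) {t c : ℝ} (ht : 0 < t) (hc : 0 < c)
    (x : EuclideanSpace ℝ (Fin N)) :
    fundSol α t x = c ^ N * fundSol α (c ^ α * t) (c • x) := by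
  have hcα : 0 < c ^ α := Real.rpow_pos_of_pos hc _
  rw [fundSol_eq_integral hα ht, fundSol_eq_integral hα (mul_pos hcα ht)]
  have h := Measure.integral_comp_inv_smul_of_nonneg (volume : Measure (EuclideanSpace ℝ (Fin N)))
    (fun ξ => Real.exp (-(c ^ α * t * stableSymbol α ξ)) *
      Real.cos (2 * Real.pi * inner ℝ ξ (c • x))) hc.le
  rw [finrank_euclideanSpace_fin, smul_eq_mul] at h
  rw [← h]
  congr 1
  ext ξ
  rw [stableSymbol_smul _ (by positivity), Real.inv_rpow hc.le, inner_smul_left, inner_smul_right]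
  congr 3
  · field_simp
  · simp; field_simp

/-- Time and position vary together because the rescaling in `tendsto_integral_abs_fundSol_sub`
moves both. Once `t i > t₀ / 2`, the exponential at time `t₀ / 2` is a common majorant. -/
lemma tendsto_fundSol (hα : 0 < α) {ι : Type*} {l : Filter ι} [l.IsCountablyGenerated]
    {t : ι → ℝ} {t₀ : ℝ} (ht₀ : 0 < t₀) (ht : Tendsto t l (𝓝 t₀))
    {x : ι → EuclideanSpace ℝ (Fin N)} {x₀ : EuclideanSpace ℝ (Fin N)}
    (hx : Tendsto x l (𝓝 x₀)) :
    Tendsto (fun i => fundSol α (t i) (x i)) l (𝓝 (fundSol α t₀ x₀)) := by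
  have hev : ∀ᶠ i in l, t₀ / 2 < t i := ht.eventually_const_lt (by linarith)
  have hc := continuous_stableSymbol (V := EuclideanSpace ℝ (Fin N)) hα.le
  rw [fundSol_eq_integral hα ht₀]
  refine Tendsto.congr' (f₁ := fun i => ∫ ξ : EuclideanSpace ℝ (Fin N),
    Real.exp (-(t i * stableSymbol α ξ)) * Real.cos (2 * Real.pi * inner ℝ ξ (x i))) ?_ ?_
  · filter_upwards [hev] with i hi
    rw [fundSol_eq_integral hα (by linarith)]
  · refine tendsto_integral_filter_of_dominated_convergence
      (fun ξ => Real.exp (-(t₀ / 2 * stableSymbol α ξ)))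
      (Eventually.of_forall fun i => Continuous.aestronglyMeasurable (by fun_prop)) ?_
      (integrable_exp_neg_stableSymbol hα (by linarith)) (ae_of_all _ fun ξ => ?_)
    · filter_upwards [hev] with i hi
      refine ae_of_all _ fun ξ => ?_
      rw [norm_mul, Real.norm_eq_abs, Real.abs_exp]
      refine (mul_le_of_le_one_right (Real.exp_pos _).le (Real.abs_cos_le_one _)).trans
        (Real.exp_le_exp.2 (neg_le_neg ?_))
      exact mul_le_mul_of_nonneg_right hi.le (stableSymbol_nonneg _ _)
    · exact ((Real.continuous_exp.tendsto _).comp (ht.mul_const _).neg).mul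
        ((Real.continuous_cos.tendsto _).comp
          ((Tendsto.inner tendsto_const_nhds hx).const_mul (2 * Real.pi)))

lemma continuous_fundSol (hα : 0 < α) {t : ℝ} (ht : 0 < t) :
    Continuous (fundSol α t : EuclideanSpace ℝ (Fin N) → ℝ) :=
  continuous_iff_continuousAt.2 fun _ => tendsto_fundSol hα ht tendsto_const_nhds tendsto_id

lemma fundSol_neg (hα : 0 < α) {t : ℝ} (ht : 0 < t) (x : EuclideanSpace ℝ (Fin N)) :
    fundSol α t (-x) = fundSol α t x := by
  simp [fundSol_eq_integral hα ht]

/-- The multiplication formula turns the left side into the average of `e^{-t|ξ|^α} ≤ 1` against a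
Gaussian of total mass one. The bound is independent of `ε`, so with `P_α ≥ 0` Fatou's lemma gives
integrability of the kernel. -/
lemma integral_fundSol_mul_gaussian_le (hα : 0 < α) {t ε : ℝ} (ht : 0 < t) (hε : 0 < ε) :
    ∫ x : EuclideanSpace ℝ (Fin N), fundSol α t x * Real.exp (-(ε * ‖x‖ ^ 2)) ≤ 1 := by
  have hi := integrable_exp_neg_stableSymbol (V := EuclideanSpace ℝ (Fin N)) hα ht
  have hgi := integrable_exp_neg_mul_norm_sq (V := EuclideanSpace ℝ (Fin N)) hε
  have hP : ∀ x : EuclideanSpace ℝ (Fin N), 𝓕 (fun ξ : EuclideanSpace ℝ (Fin N) =>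
      ((Real.exp (-(t * stableSymbol α ξ)) : ℝ) : ℂ)) x = (fundSol α t x : ℂ) := by
    intro x
    have h := congrFun (fourierInv_eq_fundSol (N := N) hα ht) (-x)
    rw [Real.fourierInv_eq_fourier_neg, neg_neg, fundSol_neg hα ht] at h
    exact h
  have hG : ∀ w : EuclideanSpace ℝ (Fin N), 𝓕 (fun x : EuclideanSpace ℝ (Fin N) =>
      ((Real.exp (-(ε * ‖x‖ ^ 2)) : ℝ) : ℂ)) w = (((Real.pi / ε) ^
        (Module.finrank ℝ (EuclideanSpace ℝ (Fin N)) / 2 : ℝ) *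
          Real.exp (-(Real.pi ^ 2 / ε) * ‖w‖ ^ 2) : ℝ) : ℂ) := by
    intro w
    have h := fourier_gaussian_innerProductSpace (V := EuclideanSpace ℝ (Fin N)) (b := (ε : ℂ))
      (by simpa using hε) w
    have e1 : (fun x : EuclideanSpace ℝ (Fin N) => ((Real.exp (-(ε * ‖x‖ ^ 2)) : ℝ) : ℂ))
        = fun x => Complex.exp (-(ε : ℂ) * ‖x‖ ^ 2) := by
      ext x; push_cast; congr 1; ring
    rw [e1, h]
    push_cast
    rw [Complex.ofReal_cpow (by positivity)]
    push_cast
    congr 2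
    ring
  have hsa : ∫ x : EuclideanSpace ℝ (Fin N), 𝓕 (fun ξ : EuclideanSpace ℝ (Fin N) =>
        ((Real.exp (-(t * stableSymbol α ξ)) : ℝ) : ℂ)) x * ((Real.exp (-(ε * ‖x‖ ^ 2)) : ℝ) : ℂ)
      = ∫ ξ : EuclideanSpace ℝ (Fin N), ((Real.exp (-(t * stableSymbol α ξ)) : ℝ) : ℂ) *
        𝓕 (fun x : EuclideanSpace ℝ (Fin N) => ((Real.exp (-(ε * ‖x‖ ^ 2)) : ℝ) : ℂ)) ξ :=
    integral_fourier_mul_eq_of_integrable hi.ofReal hgi.ofReal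
  simp_rw [hP, hG, ← Complex.ofReal_mul] at hsa
  rw [integral_complex_ofReal, integral_complex_ofReal] at hsa
  have hsa' := Complex.ofReal_injective hsa
  rw [hsa']
  have hb : 0 < Real.pi ^ 2 / ε := by positivity
  have hgauss : Integrable fun w : EuclideanSpace ℝ (Fin N) =>
      (Real.pi / ε) ^ (Module.finrank ℝ (EuclideanSpace ℝ (Fin N)) / 2 : ℝ) *
        Real.exp (-(Real.pi ^ 2 / ε) * ‖w‖ ^ 2) := by
    have := (integrable_exp_neg_mul_norm_sq (V := EuclideanSpace ℝ (Fin N)) hb).const_mul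
      ((Real.pi / ε) ^ (Module.finrank ℝ (EuclideanSpace ℝ (Fin N)) / 2 : ℝ))
    simpa only [neg_mul] using this
  have hc := continuous_stableSymbol (V := EuclideanSpace ℝ (Fin N)) hα.le
  refine (integral_mono (hgauss.bdd_mul (c := 1) (Continuous.aestronglyMeasurable (by fun_prop))
    (ae_of_all _ fun ξ => ?_)) hgauss fun ξ => ?_).trans_eq ?_
  · rw [Real.norm_eq_abs, Real.abs_exp]
    exact exp_neg_mul_stableSymbol_le_one α ht.le ξ
  · exact mul_le_of_le_one_left (by positivity) (exp_neg_mul_stableSymbol_le_one α ht.le ξ)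
  · rw [integral_const_mul, GaussianFourier.integral_rexp_neg_mul_sq_norm hb,
      ← Real.mul_rpow (by positivity) (by positivity)]
    have : Real.pi / ε * (Real.pi / (Real.pi ^ 2 / ε)) = 1 := by
      field_simp
    rw [this, Real.one_rpow]

lemma integrable_fundSol (hα : 0 < α) (hα2 : α ≤ 2) {t : ℝ} (ht : 0 < t) :
    Integrable (fundSol α t : EuclideanSpace ℝ (Fin N) → ℝ) := by
  have hc := continuous_fundSol (N := N) hα ht
  refine (integrable_and_integral_le_of_tendsto (C := 1)
    (F := fun n : ℕ => fun x : EuclideanSpace ℝ (Fin N) =>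
      fundSol α t x * Real.exp (-(1 / ((n : ℝ) + 1) * ‖x‖ ^ 2)))
    (fun n => ?_) (fun n => ae_of_all _ fun x => ?_) (fun n => ?_)
    (ae_of_all _ fun x => ?_)).1
  · refine (integrable_exp_neg_mul_norm_sq (by positivity)).bdd_mul (c := fundSol α t
      (0 : EuclideanSpace ℝ (Fin N))) hc.aestronglyMeasurable (ae_of_all _ fun x => ?_)
    rw [Real.norm_of_nonneg (fundSol_nonneg hα hα2 ht x)]
    exact fundSol_le hα ht x
  · exact mul_nonneg (fundSol_nonneg hα hα2 ht x) (Real.exp_pos _).le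
  · exact integral_fundSol_mul_gaussian_le hα ht (by positivity)
  · have h : Tendsto (fun n : ℕ => -(1 / ((n : ℝ) + 1) * ‖x‖ ^ 2)) atTop (𝓝 0) := by
      simpa using (tendsto_one_div_add_atTop_nhds_zero_nat.mul_const (‖x‖ ^ 2)).neg
    simpa [Function.comp_def] using ((Real.continuous_exp.tendsto _).comp h).const_mul
      (fundSol α t x)

lemma fourier_fundSol (hα : 0 < α) (hα2 : α ≤ 2) {t : ℝ} (ht : 0 < t) :
    𝓕 (fun x : EuclideanSpace ℝ (Fin N) => (fundSol α t x : ℂ))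
      = fun ξ => ((Real.exp (-(t * stableSymbol α ξ)) : ℝ) : ℂ) := by
  have hc := continuous_stableSymbol (V := EuclideanSpace ℝ (Fin N)) hα.le
  have hi : Integrable (𝓕⁻ (fun ξ : EuclideanSpace ℝ (Fin N) =>
      ((Real.exp (-(t * stableSymbol α ξ)) : ℝ) : ℂ))) := by
    rw [fourierInv_eq_fundSol hα ht]
    exact (integrable_fundSol hα hα2 ht).ofReal
  rw [← fourierInv_eq_fundSol hα ht]
  refine Continuous.fourier_fourierInv_eq (by fun_prop)
    (integrable_exp_neg_stableSymbol hα ht).ofReal ?_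
  have h2 := hi.comp_neg
  refine h2.congr (ae_of_all _ fun x => ?_)
  simp only [Real.fourierInv_eq_fourier_neg, neg_neg]

lemma integral_fundSol (hα : 0 < α) (hα2 : α ≤ 2) {t : ℝ} (ht : 0 < t) :
    ∫ x : EuclideanSpace ℝ (Fin N), fundSol α t x = 1 := by
  have h := congrFun (fourier_fundSol (N := N) hα hα2 ht) 0
  rw [Real.fourier_eq'] at h
  simp only [inner_zero_right, mul_zero, Complex.ofReal_zero, zero_mul, Complex.exp_zero,
    one_smul, stableSymbol_zero hα, neg_zero, Real.exp_zero, integral_complex_ofReal] at h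
  exact_mod_cast h

end HeatKernel

/-! ### The linear semigroup and its large-time profile -/

section HeatSemigroup

variable {N : ℕ} {α : ℝ}

/-- Scheffé's lemma: in `|F - f| = (F - f) + 2 (f - F)⁺` the first term has integral zero and the
second is dominated by `2 f`. -/
lemma tendsto_integral_abs_sub_of_tendsto {X ι : Type*} [MeasurableSpace X] {μ : Measure X}
    {l : Filter ι} [l.IsCountablyGenerated] {F : ι → X → ℝ} {f : X → ℝ}
    (hf : Integrable f μ) (hF : ∀ᶠ i in l, Integrable (F i) μ)
    (hF0 : ∀ᶠ i in l, ∀ x, 0 ≤ F i x) (hf0 : ∀ x, 0 ≤ f x)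
    (hint : ∀ᶠ i in l, ∫ x, F i x ∂μ = ∫ x, f x ∂μ)
    (hlim : ∀ x, Tendsto (fun i => F i x) l (𝓝 (f x))) :
    Tendsto (fun i => ∫ x, |F i x - f x| ∂μ) l (𝓝 0) := by
  have h1 : Tendsto (fun i => ∫ x, max (f x - F i x) 0 ∂μ) l (𝓝 (∫ _, (0 : ℝ) ∂μ)) := by
    refine tendsto_integral_filter_of_dominated_convergence f ?_ ?_ hf (ae_of_all _ fun x => ?_)
    · filter_upwards [hF] with i hi
      exact (hf.sub hi).pos_part.1
    · filter_upwards [hF0] with i hi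
      refine ae_of_all _ fun x => ?_
      rw [Real.norm_of_nonneg (le_max_right _ _)]
      exact max_le (by linarith [hi x]) (hf0 x)
    · have := ((hlim x).const_sub (f x)).max (tendsto_const_nhds (x := (0 : ℝ)))
      simpa using this
  rw [integral_zero] at h1
  have h2 := h1.const_mul 2
  rw [mul_zero] at h2
  refine h2.congr' ?_
  filter_upwards [hF, hint] with i hi hii
  have e : ∀ x, |F i x - f x| = (F i x - f x) + 2 * max (f x - F i x) 0 := by
    intro x
    rcases le_total (f x) (F i x) with h | h
    · rw [abs_of_nonneg (by linarith), max_eq_right (by linarith)]; ring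
    · rw [abs_of_nonpos (by linarith), max_eq_left (by linarith)]; ring
  have hs : Integrable (fun x => F i x - f x) μ := hi.sub hf
  have hp : Integrable (fun x => max (f x - F i x) 0) μ := (hf.sub hi).pos_part
  simp_rw [e]
  rw [integral_add hs (hp.const_mul 2), integral_sub hi hf, hii, integral_const_mul]
  simp

/-- The action of the semigroup `e^{-tΛ^α}` on `v`, as a convolution. -/
noncomputable def heatConv (α t : ℝ) (v : EuclideanSpace ℝ (Fin N) → ℝ)
    (x : EuclideanSpace ℝ (Fin N)) : ℝ :=
  ∫ y, v y * fundSol α t (x - y)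

lemma integrable_heatConv_integrand (hα : 0 < α) (hα2 : α ≤ 2) {t : ℝ} (ht : 0 < t)
    {v : EuclideanSpace ℝ (Fin N) → ℝ} (hv : Integrable v) :
    Integrable (fun z : EuclideanSpace ℝ (Fin N) × EuclideanSpace ℝ (Fin N) =>
      v z.2 * fundSol α t (z.1 - z.2)) (volume.prod volume) :=
  hv.convolution_integrand (ContinuousLinearMap.mul ℝ ℝ) (integrable_fundSol hα hα2 ht)

lemma integrable_heatConv (hα : 0 < α) (hα2 : α ≤ 2) {t : ℝ} (ht : 0 < t)
    {v : EuclideanSpace ℝ (Fin N) → ℝ} (hv : Integrable v) : Integrable (heatConv α t v) :=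
  (integrable_heatConv_integrand hα hα2 ht hv).integral_prod_left

lemma integral_heatConv (hα : 0 < α) (hα2 : α ≤ 2) {t : ℝ} (ht : 0 < t)
    {v : EuclideanSpace ℝ (Fin N) → ℝ} (hv : Integrable v) :
    ∫ x, heatConv α t v x = ∫ x, v x := by
  unfold heatConv
  rw [integral_integral_swap (integrable_heatConv_integrand hα hα2 ht hv)]
  congr 1
  ext y
  rw [integral_const_mul, integral_sub_right_eq_self (fundSol α t) y, integral_fundSol hα hα2 ht,
    mul_one]

lemma heatConv_nonneg (hα : 0 < α) (hα2 : α ≤ 2) {t : ℝ} (ht : 0 < t)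
    {v : EuclideanSpace ℝ (Fin N) → ℝ} (hv0 : ∀ᵐ x, 0 ≤ v x) (x : EuclideanSpace ℝ (Fin N)) :
    0 ≤ heatConv α t v x := by
  refine integral_nonneg_of_ae ?_
  filter_upwards [hv0] with y hy
  exact mul_nonneg hy (fundSol_nonneg hα hα2 ht _)

lemma heatConv_le (hα : 0 < α) (hα2 : α ≤ 2) {t : ℝ} (ht : 0 < t)
    {v : EuclideanSpace ℝ (Fin N) → ℝ} (hv : Integrable v) (hv0 : ∀ᵐ x, 0 ≤ v x)
    (x : EuclideanSpace ℝ (Fin N)) :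
    heatConv α t v x ≤ fundSol α t (0 : EuclideanSpace ℝ (Fin N)) * ∫ y, v y := by
  rw [mul_comm, ← integral_mul_const]
  refine integral_mono_of_nonneg ?_ (hv.mul_const _) ?_
  · filter_upwards [hv0] with y hy
    exact mul_nonneg hy (fundSol_nonneg hα hα2 ht _)
  · filter_upwards [hv0] with y hy
    exact mul_le_mul_of_nonneg_left (fundSol_le hα ht _) hy

lemma fourier_heatConv (hα : 0 < α) (hα2 : α ≤ 2) {t : ℝ} (ht : 0 < t)
    {v : EuclideanSpace ℝ (Fin N) → ℝ} (hv : Integrable v) (ξ : EuclideanSpace ℝ (Fin N)) :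
    𝓕 (fun x => (heatConv α t v x : ℂ)) ξ
      = 𝓕 (fun x => (v x : ℂ)) ξ * ((Real.exp (-(t * stableSymbol α ξ)) : ℝ) : ℂ) := by
  rw [← congrFun (fourier_fundSol hα hα2 ht) ξ]
  have h := Real.fourier_mul_convolution_eq (f₁ := fun x => (v x : ℂ))
    (f₂ := fun x => (fundSol α t x : ℂ)) hv.ofReal (integrable_fundSol hα hα2 ht).ofReal ξ
  have e : (fun x => (heatConv α t v x : ℂ)) = MeasureTheory.convolution (fun x => (v x : ℂ))
      (fun x => (fundSol α t x : ℂ)) (ContinuousLinearMap.mul ℂ ℂ) volume := by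
    funext x
    rw [heatConv, ← integral_complex_ofReal]
    simp [convolution]
  rw [e, h]

lemma fundSol_zero (hα : 0 < α) {t : ℝ} (ht : 0 < t) :
    fundSol α t (0 : EuclideanSpace ℝ (Fin N))
      = t ^ (-((N : ℝ) / α)) * fundSol α 1 (0 : EuclideanSpace ℝ (Fin N)) := by
  have hc : 0 < t ^ (-(1 / α)) := Real.rpow_pos_of_pos ht _
  rw [fundSol_scaling hα ht hc, smul_zero, ← Real.rpow_mul ht.le, ← Real.rpow_natCast,
    ← Real.rpow_mul ht.le]
  have e1 : t ^ (-(1 / α) * α) * t = 1 := by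
    rw [neg_mul, one_div_mul_cancel hα.ne', Real.rpow_neg_one, inv_mul_cancel₀ ht.ne']
  rw [e1]
  congr 2
  ring

lemma integral_abs_fundSol_sub_eq (hα : 0 < α) {t t' c : ℝ} (ht : 0 < t) (ht' : 0 < t')
    (hc : 0 < c) (y : EuclideanSpace ℝ (Fin N)) :
    ∫ x, |fundSol α t (x - y) - fundSol α t' x|
      = ∫ x, |fundSol α (c ^ α * t) (x - c • y) - fundSol α (c ^ α * t') x| := by
  have h := Measure.integral_comp_smul_of_nonneg (volume : Measure (EuclideanSpace ℝ (Fin N)))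
    (fun x => |fundSol α (c ^ α * t) (x - c • y) - fundSol α (c ^ α * t') x|) c (hR := hc.le)
  rw [finrank_euclideanSpace_fin, smul_eq_mul] at h
  have hcN : c ^ N ≠ 0 := (pow_pos hc N).ne'
  have e : ∫ x, |fundSol α t (x - y) - fundSol α t' x| = c ^ N *
      ∫ x, |fundSol α (c ^ α * t) (c • x - c • y) - fundSol α (c ^ α * t') (c • x)| := by
    rw [← integral_const_mul]
    congr 1
    ext x
    rw [fundSol_scaling hα ht hc, fundSol_scaling hα ht' hc, ← mul_sub, abs_mul,
      abs_of_pos (pow_pos hc N), smul_sub]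
  rw [e, h, ← mul_assoc, mul_inv_cancel₀ hcN, one_mul]

/-- Rescaling space by `t^{-1/α}` preserves the `L¹` norm, fixes the second time at `1`, sends the
first to `1 - s/t → 1` and shrinks the shift to `t^{-1/α} y → 0`. Scheffé's lemma then applies. -/
lemma tendsto_integral_abs_fundSol_sub (hα : 0 < α) (hα2 : α ≤ 2) (s : ℝ)
    (y : EuclideanSpace ℝ (Fin N)) :
    Tendsto (fun t => ∫ x, |fundSol α (t - s) (x - y) - fundSol α t x|) atTop (𝓝 0) := by
  have hc0 : Tendsto (fun t : ℝ => t ^ (-(1 / α))) atTop (𝓝 0) :=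
    tendsto_rpow_neg_atTop (by positivity)
  have hr : Tendsto (fun t : ℝ => 1 - s / t) atTop (𝓝 1) := by
    simpa using (tendsto_const_nhds (x := s)).div_atTop tendsto_id |>.const_sub 1
  have hrpos : ∀ᶠ t : ℝ in atTop, 0 < 1 - s / t := hr.eventually_const_lt zero_lt_one
  have h : Tendsto (fun t : ℝ => ∫ x : EuclideanSpace ℝ (Fin N),
      |fundSol α (1 - s / t) (x - t ^ (-(1 / α)) • y) - fundSol α 1 x|) atTop (𝓝 0) := by
    refine tendsto_integral_abs_sub_of_tendsto (integrable_fundSol hα hα2 one_pos) ?_ ?_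
      (fundSol_nonneg hα hα2 one_pos) ?_ fun x => ?_
    · filter_upwards [hrpos] with t ht
      exact (integrable_fundSol hα hα2 ht).comp_sub_right _
    · filter_upwards [hrpos] with t ht x
      exact fundSol_nonneg hα hα2 ht _
    · filter_upwards [hrpos] with t ht
      rw [integral_sub_right_eq_self (fundSol α (1 - s / t)), integral_fundSol hα hα2 ht,
        integral_fundSol hα hα2 one_pos]
    · refine tendsto_fundSol hα one_pos hr ?_
      simpa using (hc0.smul_const y).const_sub x
  refine h.congr' ?_
  filter_upwards [eventually_gt_atTop (max s 0)] with t ht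
  have ht0 : 0 < t := (le_max_right _ _).trans_lt ht
  have hts : 0 < t - s := sub_pos.2 ((le_max_left _ _).trans_lt ht)
  rw [integral_abs_fundSol_sub_eq hα hts ht0 (Real.rpow_pos_of_pos ht0 (-(1 / α)))]
  have e1 : (t ^ (-(1 / α))) ^ α = t⁻¹ := by
    rw [← Real.rpow_mul ht0.le, neg_mul, one_div_mul_cancel hα.ne', Real.rpow_neg_one]
  rw [e1, inv_mul_cancel₀ ht0.ne']
  congr 4 with x
  field_simp

lemma integral_abs_fundSol_sub_le (hα : 0 < α) (hα2 : α ≤ 2) {t t' : ℝ} (ht : 0 < t)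
    (ht' : 0 < t') (y : EuclideanSpace ℝ (Fin N)) :
    ∫ x, |fundSol α t (x - y) - fundSol α t' x| ≤ 2 := by
  have h1 := (integrable_fundSol (N := N) hα hα2 ht).comp_sub_right y
  have h2 := integrable_fundSol (N := N) hα hα2 ht'
  calc ∫ x, |fundSol α t (x - y) - fundSol α t' x|
      ≤ ∫ x, (fundSol α t (x - y) + fundSol α t' x) := by
        refine integral_mono (h1.sub h2).abs (h1.add h2) fun x => ?_
        have a := fundSol_nonneg hα hα2 ht (x - y)
        have b := fundSol_nonneg hα hα2 ht' x
        exact abs_le.2 ⟨by linarith, by linarith⟩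
    _ = 2 := by
        rw [integral_add h1 h2, integral_sub_right_eq_self (fundSol α t),
          integral_fundSol hα hα2 ht, integral_fundSol hα hα2 ht']
        norm_num

/-- The difference is a superposition over `y`, with weight `v y`, of translated kernels minus the
centred one. Each tends to zero in `L¹`, and the norms are at most `2`, so `2 |v|` is a majorant. -/
lemma tendsto_integral_abs_heatConv_sub (hα : 0 < α) (hα2 : α ≤ 2) (s : ℝ)
    {v : EuclideanSpace ℝ (Fin N) → ℝ} (hv : Integrable v) :
    Tendsto (fun t => ∫ x, |heatConv α (t - s) v x - (∫ y, v y) * fundSol α t x|) atTop (𝓝 0) := by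
  have hint : ∀ t, max s 0 < t →
      Integrable (fun z : EuclideanSpace ℝ (Fin N) × EuclideanSpace ℝ (Fin N) =>
        v z.2 * (fundSol α (t - s) (z.1 - z.2) - fundSol α t z.1)) (volume.prod volume) := by
    intro t ht
    have ht0 : 0 < t := (le_max_right _ _).trans_lt ht
    have hts : 0 < t - s := sub_pos.2 ((le_max_left _ _).trans_lt ht)
    have h1 := integrable_heatConv_integrand hα hα2 hts hv
    have h2 := (integrable_fundSol (N := N) hα hα2 ht0).mul_prod hv
    refine (h1.sub h2).congr (ae_of_all _ fun z => ?_)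
    simp only [Pi.sub_apply]
    ring
  have hlim : Tendsto (fun t => ∫ y, |v y| * ∫ x, |fundSol α (t - s) (x - y) - fundSol α t x|)
      atTop (𝓝 (∫ y, |v y| * 0)) := by
    refine tendsto_integral_filter_of_dominated_convergence (fun y => |v y| * 2) ?_ ?_
      (hv.abs.mul_const 2)
      (ae_of_all _ fun y => (tendsto_integral_abs_fundSol_sub hα hα2 s y).const_mul _)
    · filter_upwards [eventually_gt_atTop (max s 0)] with t ht
      have := (hint t ht).abs.integral_prod_right.1
      simpa only [abs_mul, integral_const_mul] using this
    · filter_upwards [eventually_gt_atTop (max s 0)] with t ht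
      have ht0 : 0 < t := (le_max_right _ _).trans_lt ht
      have hts : 0 < t - s := sub_pos.2 ((le_max_left _ _).trans_lt ht)
      refine ae_of_all _ fun y => ?_
      rw [Real.norm_of_nonneg (mul_nonneg (abs_nonneg _) (integral_nonneg fun x => abs_nonneg _))]
      exact mul_le_mul_of_nonneg_left (integral_abs_fundSol_sub_le hα hα2 hts ht0 y) (abs_nonneg _)
  simp only [mul_zero, integral_zero] at hlim
  refine squeeze_zero' (Eventually.of_forall fun t => integral_nonneg fun x => abs_nonneg _) ?_ hlim
  filter_upwards [eventually_gt_atTop (max s 0)] with t ht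
  have ht0 : 0 < t := (le_max_right _ _).trans_lt ht
  have hts : 0 < t - s := sub_pos.2 ((le_max_left _ _).trans_lt ht)
  have h1 := (integrable_heatConv_integrand hα hα2 hts hv).prod_right_ae
  calc ∫ x, |heatConv α (t - s) v x - (∫ y, v y) * fundSol α t x|
      ≤ ∫ x, ∫ y, |v y * (fundSol α (t - s) (x - y) - fundSol α t x)| := by
        refine integral_mono_ae ((integrable_heatConv hα hα2 hts hv).sub
          ((integrable_fundSol hα hα2 ht0).const_mul _)).abs
          (hint t ht).abs.integral_prod_left ?_
        filter_upwards [h1] with x hx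
        have e : heatConv α (t - s) v x - (∫ y, v y) * fundSol α t x
            = ∫ y, v y * (fundSol α (t - s) (x - y) - fundSol α t x) := by
          simp_rw [mul_sub]
          rw [integral_sub hx (hv.mul_const _), integral_mul_const, heatConv]
        rw [e]
        exact abs_integral_le_integral_abs
    _ = ∫ y, ∫ x, |v y * (fundSol α (t - s) (x - y) - fundSol α t x)| :=
        integral_integral_swap (hint t ht).abs
    _ = ∫ y, |v y| * ∫ x, |fundSol α (t - s) (x - y) - fundSol α t x| := by
        simp_rw [abs_mul, integral_const_mul]

end HeatSemigroup

/-! ### The fractional Laplacian of modulated cut-offs -/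

section FractionalLaplacian

variable {N : ℕ} {α : ℝ}

lemma stableSymbol_le {V : Type*} [NormedAddCommGroup V] (hα : 0 < α) (hα2 : α ≤ 2) (ξ : V) :
    stableSymbol α ξ ≤ (2 * Real.pi) ^ α * (1 + ‖ξ‖ ^ 2) := by
  rw [stableSymbol, Real.mul_rpow (by positivity) (norm_nonneg _)]
  refine mul_le_mul_of_nonneg_left ?_ (by positivity)
  rcases le_total ‖ξ‖ 1 with h | h
  · have := Real.rpow_le_one (norm_nonneg _) h hα.le
    nlinarith [sq_nonneg ‖ξ‖]
  · have := Real.rpow_le_rpow_of_exponent_le h hα2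
    rw [Real.rpow_two] at this
    linarith

lemma integrable_of_contDiff_hasCompactSupport {Φ : EuclideanSpace ℝ (Fin N) → ℂ}
    (hΦ : ContDiff ℝ ∞ Φ) (hs : HasCompactSupport Φ) : Integrable Φ :=
  hΦ.continuous.integrable_of_hasCompactSupport hs

lemma integrable_pow_mul_fourier {Φ : EuclideanSpace ℝ (Fin N) → ℂ}
    (hΦ : ContDiff ℝ ∞ Φ) (hs : HasCompactSupport Φ) (k : ℕ) :
    Integrable fun ξ => ‖ξ‖ ^ k * ‖𝓕 Φ ξ‖ := by
  have := (𝓕 (hs.toSchwartzMap hΦ)).integrable_pow_mul volume k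
  simpa [SchwartzMap.fourier_coe] using! this

lemma integrable_fourier {Φ : EuclideanSpace ℝ (Fin N) → ℂ}
    (hΦ : ContDiff ℝ ∞ Φ) (hs : HasCompactSupport Φ) : Integrable (𝓕 Φ) := by
  have := (𝓕 (hs.toSchwartzMap hΦ)).integrable (μ := volume)
  simpa [SchwartzMap.fourier_coe] using! this

lemma integrable_stableSymbol_mul_fourier (hα : 0 < α) (hα2 : α ≤ 2)
    {Φ : EuclideanSpace ℝ (Fin N) → ℂ} (hΦ : ContDiff ℝ ∞ Φ) (hs : HasCompactSupport Φ) :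
    Integrable fun ξ => (stableSymbol α ξ : ℂ) * 𝓕 Φ ξ := by
  have h0 := (integrable_fourier hΦ hs).norm
  have h2 := integrable_pow_mul_fourier hΦ hs 2
  have hc := continuous_stableSymbol (V := EuclideanSpace ℝ (Fin N)) hα.le
  refine ((h0.add h2).const_mul ((2 * Real.pi) ^ α)).mono'
    ((Complex.continuous_ofReal.comp hc).aestronglyMeasurable.mul (integrable_fourier hΦ hs).1)
    (ae_of_all _ fun ξ => ?_)
  rw [norm_mul, Complex.norm_real, Real.norm_of_nonneg (stableSymbol_nonneg _ _)]
  refine (mul_le_mul_of_nonneg_right (stableSymbol_le hα hα2 ξ) (norm_nonneg _)).trans_eq ?_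
  simp only [Pi.add_apply]
  ring

lemma conj_fourier_ofReal (f : EuclideanSpace ℝ (Fin N) → ℝ) (ξ : EuclideanSpace ℝ (Fin N)) :
    (starRingEnd ℂ) (𝓕 (fun x => (f x : ℂ)) ξ) = 𝓕 (fun x => (f x : ℂ)) (-ξ) := by
  rw [Real.fourier_eq', Real.fourier_eq', ← integral_conj]
  congr 1
  ext x
  simp [← Complex.exp_conj, map_ofNat]

lemma conj_fourierInv_stableSymbol_mul_fourier (f : EuclideanSpace ℝ (Fin N) → ℝ)
    (x : EuclideanSpace ℝ (Fin N)) :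
    (starRingEnd ℂ) (𝓕⁻ (fun ξ => (stableSymbol α ξ : ℂ) * 𝓕 (fun x => (f x : ℂ)) ξ) x)
      = 𝓕⁻ (fun ξ => (stableSymbol α ξ : ℂ) * 𝓕 (fun x => (f x : ℂ)) ξ) x := by
  rw [Real.fourierInv_eq', ← integral_conj]
  rw [← integral_neg_eq_self]
  congr 1
  ext ξ
  simp [← Complex.exp_conj, conj_fourier_ofReal, map_ofNat]

/-- The symbol is real and even, so the multiplier maps real functions to real functions and
commutes with taking real parts. Complex modulations can therefore be used although test functions
are real. -/
lemma fracLaplacian_re (hα : 0 < α) (hα2 : α ≤ 2) {Φ : EuclideanSpace ℝ (Fin N) → ℂ}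
    (hΦ : ContDiff ℝ ∞ Φ) (hs : HasCompactSupport Φ) (x : EuclideanSpace ℝ (Fin N)) :
    fracLaplacian α (fun x => (Φ x).re) x
      = (𝓕⁻ (fun ξ => (stableSymbol α ξ : ℂ) * 𝓕 Φ ξ) x).re := by
  have hre : ContDiff ℝ ∞ fun x => ((Φ x).re : ℂ) :=
    Complex.ofRealCLM.contDiff.comp (Complex.reCLM.contDiff.comp hΦ)
  have him : ContDiff ℝ ∞ fun x => ((Φ x).im : ℂ) :=
    Complex.ofRealCLM.contDiff.comp (Complex.imCLM.contDiff.comp hΦ)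
  have hsre : HasCompactSupport fun x => ((Φ x).re : ℂ) :=
    hs.comp_left (g := fun z : ℂ => (z.re : ℂ)) (by simp)
  have hsim : HasCompactSupport fun x => ((Φ x).im : ℂ) :=
    hs.comp_left (g := fun z : ℂ => (z.im : ℂ)) (by simp)
  have h1 : ∀ ξ, 𝓕 Φ ξ = 𝓕 (fun x => ((Φ x).re : ℂ)) ξ
      + Complex.I * 𝓕 (fun x => ((Φ x).im : ℂ)) ξ := by
    intro ξ
    have i1 := (Real.fourierIntegral_convergent_iff (μ := volume) ξ).2
      (integrable_of_contDiff_hasCompactSupport hre hsre)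
    have i2 := (Real.fourierIntegral_convergent_iff (μ := volume) ξ).2
      (integrable_of_contDiff_hasCompactSupport him hsim)
    rw [Real.fourier_eq, Real.fourier_eq, Real.fourier_eq, ← integral_const_mul,
      ← integral_add i1 (i2.const_mul _)]
    congr 1
    ext y
    simp only [Circle.smul_def, smul_eq_mul]
    conv_lhs => rw [← Complex.re_add_im (Φ y)]
    ring
  have h2 : 𝓕⁻ (fun ξ => (stableSymbol α ξ : ℂ) * 𝓕 Φ ξ) x
      = 𝓕⁻ (fun ξ => (stableSymbol α ξ : ℂ) * 𝓕 (fun x => ((Φ x).re : ℂ)) ξ) x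
        + Complex.I * 𝓕⁻ (fun ξ => (stableSymbol α ξ : ℂ) * 𝓕 (fun x => ((Φ x).im : ℂ)) ξ) x := by
    have i1 := (Real.fourierIntegral_convergent_iff (μ := volume) (-x)).2
      (integrable_stableSymbol_mul_fourier hα hα2 hre hsre)
    have i2 := (Real.fourierIntegral_convergent_iff (μ := volume) (-x)).2
      (integrable_stableSymbol_mul_fourier hα hα2 him hsim)
    simp only [inner_neg_right, neg_neg] at i1 i2
    rw [Real.fourierInv_eq, Real.fourierInv_eq, Real.fourierInv_eq, ← integral_const_mul,
      ← integral_add i1 (i2.const_mul _)]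
    congr 1
    ext ξ
    simp only [Circle.smul_def, smul_eq_mul, h1]
    ring
  have h3 : (𝓕⁻ (fun ξ => (stableSymbol α ξ : ℂ) * 𝓕 (fun x => ((Φ x).im : ℂ)) ξ) x).im = 0 :=
    Complex.conj_eq_iff_im.1 (conj_fourierInv_stableSymbol_mul_fourier _ x)
  rw [h2, Complex.add_re, Complex.I_mul_re, h3, neg_zero, add_zero]
  rfl

lemma continuous_fracLaplacian (hα : 0 < α) (hα2 : α ≤ 2) {φ : EuclideanSpace ℝ (Fin N) → ℝ}
    (hφ : ContDiff ℝ ∞ φ) (hs : HasCompactSupport φ) : Continuous (fracLaplacian α φ) := by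
  have h := integrable_stableSymbol_mul_fourier hα hα2 (Complex.ofRealCLM.contDiff.comp hφ)
    (hs.comp_left (g := fun z : ℝ => (z : ℂ)) (by simp))
  have hc : Continuous (𝓕 fun ξ => (stableSymbol α ξ : ℂ) *
      𝓕 (fun x : EuclideanSpace ℝ (Fin N) => (φ x : ℂ)) ξ) :=
    VectorFourier.fourierIntegral_continuous Real.continuous_fourierChar
      (by exact continuous_inner) h
  have h2 := Complex.continuous_re.comp (hc.comp continuous_neg)
  refine h2.congr fun x => ?_
  rw [fracLaplacian, Real.fourierInv_eq_fourier_neg]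
  rfl

lemma exists_abs_fracLaplacian_le (α : ℝ) (φ : EuclideanSpace ℝ (Fin N) → ℝ) :
    ∃ C, ∀ x, |fracLaplacian α φ x| ≤ C := by
  refine ⟨∫ ξ, ‖(((2 * Real.pi * ‖ξ‖) ^ α : ℝ) : ℂ) *
    𝓕 (fun y : EuclideanSpace ℝ (Fin N) => (φ y : ℂ)) ξ‖,
    fun x => (Complex.abs_re_le_norm _).trans ?_⟩
  rw [Real.fourierInv_eq]
  -- For a non-integrable integrand both integrals are zero by convention.
  refine (norm_integral_le_integral_norm _).trans (le_of_eq ?_)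
  simp only [Circle.norm_smul]

/-- The modulated and rescaled function `y ↦ c χ(εy) e^{2πi⟨y, η⟩}`. -/
noncomputable def modulated (χ : EuclideanSpace ℝ (Fin N) → ℝ) (c : ℂ)
    (η : EuclideanSpace ℝ (Fin N)) (ε : ℝ) (y : EuclideanSpace ℝ (Fin N)) : ℂ :=
  c * Complex.exp ((2 * Real.pi * inner ℝ y η : ℝ) * Complex.I) * (χ (ε • y) : ℂ)

lemma fourier_modulated (χ : EuclideanSpace ℝ (Fin N) → ℝ) (c : ℂ)
    (η : EuclideanSpace ℝ (Fin N)) {ε : ℝ} (hε : 0 < ε) (ζ : EuclideanSpace ℝ (Fin N)) :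
    𝓕 (modulated χ c η ε) (η + ε • ζ) = c * ((ε ^ N)⁻¹ : ℝ) * 𝓕 (fun x => (χ x : ℂ)) ζ := by
  rw [Real.fourier_eq', Real.fourier_eq']
  have h := Measure.integral_comp_smul_of_nonneg (volume : Measure (EuclideanSpace ℝ (Fin N)))
    (fun x => Complex.exp ((↑(-2 * Real.pi * inner ℝ x ζ) * Complex.I)) • (χ x : ℂ)) ε
    (hR := hε.le)
  rw [finrank_euclideanSpace_fin] at h
  rw [mul_assoc, ← Complex.real_smul, ← h, ← integral_const_mul]
  congr 1
  ext y
  simp only [modulated, smul_eq_mul]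
  have : Complex.exp (↑(-2 * Real.pi * inner ℝ y (η + ε • ζ)) * Complex.I) *
      Complex.exp ((2 * Real.pi * inner ℝ y η : ℝ) * Complex.I)
      = Complex.exp (↑(-2 * Real.pi * inner ℝ (ε • y) ζ) * Complex.I) := by
    rw [← Complex.exp_add, ← add_mul, ← Complex.ofReal_add]
    congr 3
    rw [inner_add_right, inner_smul_right, real_inner_smul_left]
    ring
  rw [← this]
  ring

/-- The transform of the modulated cut-off concentrates near `η` at scale `ε`. Substituting `ξ = η +
ε ζ` cancels the factor `ε^{-N}` and leaves `ε` only in the phase and the symbol, so uniform bounds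
and the limit `ε → 0` are immediate. -/
lemma fourierInv_stableSymbol_mul_modulated (χ : EuclideanSpace ℝ (Fin N) → ℝ) (c : ℂ)
    (η : EuclideanSpace ℝ (Fin N)) {ε : ℝ} (hε : 0 < ε) (x : EuclideanSpace ℝ (Fin N)) :
    𝓕⁻ (fun ξ => (stableSymbol α ξ : ℂ) * 𝓕 (modulated χ c η ε) ξ) x
      = ∫ ζ, Complex.exp (↑(2 * Real.pi * inner ℝ (η + ε • ζ) x) * Complex.I) *
          (stableSymbol α (η + ε • ζ) : ℂ) * (c * 𝓕 (fun x => (χ x : ℂ)) ζ) := by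
  rw [Real.fourierInv_eq']
  rw [← integral_add_left_eq_self _ η]
  have h := Measure.integral_comp_smul_of_nonneg (volume : Measure (EuclideanSpace ℝ (Fin N)))
    (fun ξ => Complex.exp (↑(2 * Real.pi * inner ℝ (η + ξ) x) * Complex.I) •
      ((stableSymbol α (η + ξ) : ℂ) * 𝓕 (modulated χ c η ε) (η + ξ))) ε (hR := hε.le)
  rw [finrank_euclideanSpace_fin] at h
  have hεN : ε ^ N ≠ 0 := (pow_pos hε N).ne'
  have h2 := congrArg (fun z : ℂ => (ε ^ N : ℝ) • z) h
  simp only [smul_inv_smul₀ hεN] at h2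
  rw [← h2, ← integral_smul]
  congr 1
  ext ζ
  rw [fourier_modulated χ c η hε, Complex.real_smul, smul_eq_mul]
  have : ((ε ^ N : ℝ) : ℂ) * ((ε ^ N)⁻¹ : ℝ) = 1 := by
    rw [← Complex.ofReal_mul, mul_inv_cancel₀ hεN, Complex.ofReal_one]
  linear_combination (Complex.exp (↑(2 * Real.pi * inner ℝ (η + ε • ζ) x) * Complex.I) *
      (stableSymbol α (η + ε • ζ) : ℂ) * (c * 𝓕 (fun x => (χ x : ℂ)) ζ)) * this

lemma stableSymbol_add_smul_le (hα : 0 < α) (hα2 : α ≤ 2) (η ζ : EuclideanSpace ℝ (Fin N))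
    {ε : ℝ} (hε : 0 < ε) (hε1 : ε ≤ 1) :
    stableSymbol α (η + ε • ζ) ≤ (2 * Real.pi) ^ α * (1 + 2 * ‖η‖ ^ 2 + 2 * ‖ζ‖ ^ 2) := by
  refine (stableSymbol_le hα hα2 _).trans (mul_le_mul_of_nonneg_left ?_ (by positivity))
  have h1 : ‖η + ε • ζ‖ ≤ ‖η‖ + ‖ζ‖ := by
    refine (norm_add_le _ _).trans (add_le_add le_rfl ?_)
    rw [norm_smul, Real.norm_of_nonneg hε.le]
    exact mul_le_of_le_one_left (norm_nonneg _) hε1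
  have h2 : ‖η + ε • ζ‖ ^ 2 ≤ (‖η‖ + ‖ζ‖) ^ 2 := pow_le_pow_left₀ (norm_nonneg _) h1 2
  nlinarith [sq_nonneg (‖η‖ - ‖ζ‖)]

variable {χ : EuclideanSpace ℝ (Fin N) → ℝ}

lemma contDiff_modulated (hχ : ContDiff ℝ ∞ χ) (c : ℂ) (η : EuclideanSpace ℝ (Fin N)) (ε : ℝ) :
    ContDiff ℝ ∞ (modulated χ c η ε) := by
  unfold modulated
  have h1 : ContDiff ℝ ∞ fun y : EuclideanSpace ℝ (Fin N) => ((χ (ε • y) : ℝ) : ℂ) :=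
    Complex.ofRealCLM.contDiff.comp (hχ.comp (contDiff_const_smul ε))
  have h2 : ContDiff ℝ ∞ fun y : EuclideanSpace ℝ (Fin N) =>
      ((2 * Real.pi * inner ℝ y η : ℝ) : ℂ) :=
    Complex.ofRealCLM.contDiff.comp (contDiff_const.mul (contDiff_id.inner ℝ contDiff_const))
  exact (contDiff_const.mul (h2.mul contDiff_const).cexp).mul h1

lemma hasCompactSupport_modulated (hs : HasCompactSupport χ) (c : ℂ)
    (η : EuclideanSpace ℝ (Fin N)) {ε : ℝ} (hε : 0 < ε) :
    HasCompactSupport (modulated χ c η ε) := by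
  have h1 : HasCompactSupport fun y => ((χ (ε • y) : ℝ) : ℂ) :=
    (hs.comp_smul hε.ne').comp_left (g := fun z : ℝ => (z : ℂ)) (by simp)
  exact h1.mul_left

/-- Uniform bound for the fractional Laplacian of modulated cut-offs. -/
noncomputable def modulatedBound (α : ℝ) (χ : EuclideanSpace ℝ (Fin N) → ℝ) (c : ℂ)
    (η ζ : EuclideanSpace ℝ (Fin N)) : ℝ :=
  (2 * Real.pi) ^ α * (1 + 2 * ‖η‖ ^ 2 + 2 * ‖ζ‖ ^ 2) * (‖c‖ * ‖𝓕 (fun x => (χ x : ℂ)) ζ‖)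

lemma integrable_modulatedBound (hχ : ContDiff ℝ ∞ χ) (hs : HasCompactSupport χ) (c : ℂ)
    (η : EuclideanSpace ℝ (Fin N)) : Integrable (modulatedBound α χ c η) := by
  have hχ' : ContDiff ℝ ∞ fun x => (χ x : ℂ) := Complex.ofRealCLM.contDiff.comp hχ
  have hs' : HasCompactSupport fun x => (χ x : ℂ) :=
    hs.comp_left (g := fun z : ℝ => (z : ℂ)) (by simp)
  have h0 := (integrable_fourier hχ' hs').norm.const_mul
    ((2 * Real.pi) ^ α * (1 + 2 * ‖η‖ ^ 2) * ‖c‖)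
  have h2 := (integrable_pow_mul_fourier hχ' hs' 2).const_mul ((2 * Real.pi) ^ α * 2 * ‖c‖)
  refine (h0.add h2).congr (ae_of_all _ fun ζ => ?_)
  simp only [modulatedBound, Pi.add_apply]
  ring

lemma norm_modulated_integrand_le (hα : 0 < α) (hα2 : α ≤ 2) (χ : EuclideanSpace ℝ (Fin N) → ℝ)
    (c : ℂ) (η x ζ : EuclideanSpace ℝ (Fin N)) {ε : ℝ} (hε : 0 < ε) (hε1 : ε ≤ 1) :
    ‖Complex.exp (↑(2 * Real.pi * inner ℝ (η + ε • ζ) x) * Complex.I) *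
      (stableSymbol α (η + ε • ζ) : ℂ) * (c * 𝓕 (fun x => (χ x : ℂ)) ζ)‖
      ≤ modulatedBound α χ c η ζ := by
  rw [norm_mul, norm_mul, norm_mul, Complex.norm_exp_ofReal_mul_I, one_mul, Complex.norm_real,
    Real.norm_of_nonneg (stableSymbol_nonneg _ _)]
  exact mul_le_mul_of_nonneg_right (stableSymbol_add_smul_le hα hα2 η ζ hε hε1) (by positivity)

lemma abs_fracLaplacian_modulated_le (hα : 0 < α) (hα2 : α ≤ 2) (hχ : ContDiff ℝ ∞ χ)
    (hs : HasCompactSupport χ) (c : ℂ) (η x : EuclideanSpace ℝ (Fin N)) {ε : ℝ} (hε : 0 < ε)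
    (hε1 : ε ≤ 1) :
    |fracLaplacian α (fun y => (modulated χ c η ε y).re) x| ≤ ∫ ζ, modulatedBound α χ c η ζ := by
  rw [fracLaplacian_re hα hα2 (contDiff_modulated hχ c η ε) (hasCompactSupport_modulated hs c η hε),
    fourierInv_stableSymbol_mul_modulated χ c η hε]
  exact (Complex.abs_re_le_norm _).trans (norm_integral_le_of_norm_le
    (integrable_modulatedBound hχ hs c η) (ae_of_all _ fun ζ =>
      norm_modulated_integrand_le hα hα2 χ c η x ζ hε hε1))

/-- In the limit a plane wave appears as an eigenfunction of `Λ^α` with eigenvalue `stableSymbol α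
η`. -/
lemma tendsto_fracLaplacian_modulated (hα : 0 < α) (hα2 : α ≤ 2) (hχ : ContDiff ℝ ∞ χ)
    (hs : HasCompactSupport χ) (hχ0 : χ 0 = 1) (c : ℂ) (η x : EuclideanSpace ℝ (Fin N))
    {ε : ℕ → ℝ} (hε : ∀ n, 0 < ε n) (hε1 : ∀ n, ε n ≤ 1) (hεlim : Tendsto ε atTop (𝓝 0)) :
    Tendsto (fun n => fracLaplacian α (fun y => (modulated χ c η (ε n) y).re) x) atTop
      (𝓝 (stableSymbol α η *
        (c * Complex.exp ((2 * Real.pi * inner ℝ x η : ℝ) * Complex.I)).re)) := by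
  have hχ' : ContDiff ℝ ∞ fun x => (χ x : ℂ) := Complex.ofRealCLM.contDiff.comp hχ
  have hs' : HasCompactSupport fun x => (χ x : ℂ) :=
    hs.comp_left (g := fun z : ℝ => (z : ℂ)) (by simp)
  have hF := integrable_fourier hχ' hs'
  have hc := continuous_stableSymbol (V := EuclideanSpace ℝ (Fin N)) hα.le
  -- Fourier inversion at the origin, where `χ 0 = 1`.
  have hint : ∫ ζ, 𝓕 (fun x => (χ x : ℂ)) ζ = 1 := by
    have h := congrFun (hχ'.continuous.fourierInv_fourier_eq
      (integrable_of_contDiff_hasCompactSupport hχ' hs') hF) 0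
    rw [Real.fourierInv_eq'] at h
    simpa [hχ0] using h
  have hlim : Tendsto (fun n => ∫ ζ,
      Complex.exp (↑(2 * Real.pi * inner ℝ (η + ε n • ζ) x) * Complex.I) *
        (stableSymbol α (η + ε n • ζ) : ℂ) * (c * 𝓕 (fun x => (χ x : ℂ)) ζ)) atTop
      (𝓝 (∫ ζ, Complex.exp (↑(2 * Real.pi * inner ℝ η x) * Complex.I) *
        (stableSymbol α η : ℂ) * (c * 𝓕 (fun x => (χ x : ℂ)) ζ))) := by
    refine tendsto_integral_of_dominated_convergence (modulatedBound α χ c η) (fun n => ?_)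
      (integrable_modulatedBound hχ hs c η) (fun n => ae_of_all _ fun ζ =>
        norm_modulated_integrand_le hα hα2 χ c η x ζ (hε n) (hε1 n)) (ae_of_all _ fun ζ => ?_)
    · refine AEStronglyMeasurable.mul (Continuous.aestronglyMeasurable ?_) (hF.1.const_mul c)
      fun_prop
    · refine Tendsto.mul_const _ ?_
      have hη : Tendsto (fun n => η + ε n • ζ) atTop (𝓝 η) := by
        simpa using (hεlim.smul_const ζ).const_add η
      have hcont : Continuous fun w : EuclideanSpace ℝ (Fin N) =>
          Complex.exp (↑(2 * Real.pi * inner ℝ w x) * Complex.I) * (stableSymbol α w : ℂ) := by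
        fun_prop
      exact (hcont.tendsto η).comp hη
  have e : ∀ n, fracLaplacian α (fun y => (modulated χ c η (ε n) y).re) x
      = (∫ ζ, Complex.exp (↑(2 * Real.pi * inner ℝ (η + ε n • ζ) x) * Complex.I) *
        (stableSymbol α (η + ε n • ζ) : ℂ) * (c * 𝓕 (fun x => (χ x : ℂ)) ζ)).re := fun n => by
    rw [fracLaplacian_re hα hα2 (contDiff_modulated hχ c η _)
      (hasCompactSupport_modulated hs c η (hε n)),
      fourierInv_stableSymbol_mul_modulated χ c η (hε n)]
  simp_rw [e]
  convert (Complex.continuous_re.tendsto _).comp hlim using 2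
  · rfl
  rw [integral_const_mul, integral_const_mul, hint, real_inner_comm, mul_one,
    ← Complex.re_ofReal_mul]
  congr 1
  ring

end FractionalLaplacian

/-! ### From the weak formulation to an equation for each Fourier mode -/

section WeakSolution

lemma volume_restrict_prod {N : ℕ} (I : Set ℝ) (K : Set (EuclideanSpace ℝ (Fin N))) :
    (volume : Measure (ℝ × EuclideanSpace ℝ (Fin N))).restrict (I ×ˢ K)
      = (volume.restrict I).prod (volume.restrict K) := by
  rw [Measure.volume_eq_prod, Measure.prod_restrict]

lemma re_mul_integral_ofReal_mul {X : Type*} [MeasurableSpace X] {μ : Measure X} {f : X → ℝ}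
    (hf : Integrable f μ) {E : X → ℂ} (hE : AEStronglyMeasurable E μ) (hE1 : ∀ x, ‖E x‖ ≤ 1)
    (c : ℂ) : (c * ∫ x, (f x : ℂ) * E x ∂μ).re = ∫ x, f x * (c * E x).re ∂μ := by
  have hi : Integrable (fun x => c * ((f x : ℂ) * E x)) μ :=
    ((hf.ofReal.mul_bdd (c := 1) hE (ae_of_all _ hE1))).const_mul c
  rw [← integral_const_mul, ← RCLike.re_eq_complex_re, ← integral_re hi]
  congr 1
  ext x
  rw [RCLike.re_eq_complex_re, ← Complex.re_ofReal_mul]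
  congr 1
  ring

variable {N : ℕ} {α p : ℝ} {u₀ : EuclideanSpace ℝ (Fin N) → ℝ}
  {u : ℝ → EuclideanSpace ℝ (Fin N) → ℝ}

/-- The plane wave `x ↦ e^{2πi⟨x, η⟩}`. -/
noncomputable def planeWave (η x : EuclideanSpace ℝ (Fin N)) : ℂ :=
  Complex.exp ((2 * Real.pi * inner ℝ x η : ℝ) * Complex.I)

lemma norm_planeWave (η x : EuclideanSpace ℝ (Fin N)) : ‖planeWave η x‖ = 1 :=
  Complex.norm_exp_ofReal_mul_I _

lemma continuous_planeWave (η : EuclideanSpace ℝ (Fin N)) : Continuous (planeWave η) := by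
  unfold planeWave
  fun_prop

lemma abs_re_mul_planeWave_le (c : ℂ) (η x : EuclideanSpace ℝ (Fin N)) :
    |(c * planeWave η x).re| ≤ ‖c‖ := by
  refine (Complex.abs_re_le_norm _).trans_eq ?_
  rw [norm_mul, norm_planeWave, mul_one]

lemma modulated_re (χ : EuclideanSpace ℝ (Fin N) → ℝ) (c : ℂ) (η : EuclideanSpace ℝ (Fin N))
    (ε : ℝ) (y : EuclideanSpace ℝ (Fin N)) :
    (modulated χ c η ε y).re = (c * planeWave η y).re * χ (ε • y) := by
  rw [modulated, Complex.re_mul_ofReal, planeWave]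

lemma fourier_eq_integral_planeWave (f : EuclideanSpace ℝ (Fin N) → ℝ)
    (ξ : EuclideanSpace ℝ (Fin N)) :
    𝓕 (fun x => (f x : ℂ)) ξ = ∫ x, (f x : ℂ) * planeWave (-ξ) x := by
  rw [Real.fourier_eq']
  congr 1
  ext x
  rw [smul_eq_mul, mul_comm, planeWave, inner_neg_right]
  congr 4
  ring

namespace IsNonnegWeakSolution

lemma integrable_prod (hu : IsNonnegWeakSolution α (-1) p u₀ u) {T : ℝ} (hT : 0 < T) :
    Integrable (fun z : ℝ × EuclideanSpace ℝ (Fin N) => u z.1 z.2)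
      ((volume.restrict (Ioc 0 T)).prod volume) := by
  have := hu.integrable_time T hT
  rwa [IntegrableOn, volume_restrict_prod, Measure.restrict_univ] at this

/-- Nonnegativity is given slice by slice; by Fubini the negative part has zero integral on the
product, hence vanishes almost everywhere there. -/
lemma nonneg_prod (hu : IsNonnegWeakSolution α (-1) p u₀ u) {T : ℝ} (hT : 0 < T) :
    ∀ᵐ z ∂((volume.restrict (Ioc 0 T)).prod (volume : Measure (EuclideanSpace ℝ (Fin N)))),
      0 ≤ u z.1 z.2 := by
  have hi := (hu.integrable_prod hT).neg_part
  have h0 : ∫ z : ℝ × EuclideanSpace ℝ (Fin N), max (-u z.1 z.2) 0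
      ∂((volume.restrict (Ioc 0 T)).prod volume) = 0 := by
    rw [integral_prod _ hi]
    refine integral_eq_zero_of_ae ?_
    filter_upwards [ae_restrict_mem measurableSet_Ioc] with s hs
    refine integral_eq_zero_of_ae ?_
    filter_upwards [hu.nonneg s hs.1] with x hx
    exact max_eq_right (by linarith)
  have h1 := (integral_eq_zero_iff_of_nonneg (f := fun z : ℝ × EuclideanSpace ℝ (Fin N) =>
    max (-u z.1 z.2) 0) (fun z => le_max_right _ _) hi).1 h0
  filter_upwards [h1] with z hz
  have := max_eq_right_iff.1 hz
  linarith

lemma integrable_pow_mul (hu : IsNonnegWeakSolution α (-1) p u₀ u) {T : ℝ} (hT : 0 < T)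
    {φ : EuclideanSpace ℝ (Fin N) → ℝ} (hφ : Continuous φ) (hs : HasCompactSupport φ) :
    Integrable (fun z : ℝ × EuclideanSpace ℝ (Fin N) => u z.1 z.2 ^ p * φ z.2)
      ((volume.restrict (Ioc 0 T)).prod volume) := by
  have h := hu.integrable_pow T hT (tsupport φ) hs.isCompact
  obtain ⟨C, hC⟩ := hs.exists_bound_of_continuous hφ
  have h2 : IntegrableOn (fun z : ℝ × EuclideanSpace ℝ (Fin N) => u z.1 z.2 ^ p * φ z.2)
      (Ioc 0 T ×ˢ tsupport φ) :=
    Integrable.mul_bdd (c := C) h (hφ.comp continuous_snd).aestronglyMeasurable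
      (ae_of_all _ fun z => hC z.2)
  have h3 : (volume.restrict (Ioc 0 T)).prod (volume : Measure (EuclideanSpace ℝ (Fin N)))
      = volume.restrict (Ioc 0 T ×ˢ univ) := by
    rw [volume_restrict_prod, Measure.restrict_univ]
  rw [h3, ← integrableOn_iff_integrable_of_support_subset
    (s := univ ×ˢ tsupport φ)]
  · rw [IntegrableOn, Measure.restrict_restrict (MeasurableSet.univ.prod
      (isClosed_tsupport φ).measurableSet), prod_inter_prod, univ_inter, inter_univ]
    exact h2
  · intro z hz
    exact ⟨mem_univ _, subset_tsupport _ (right_ne_zero_of_mul hz)⟩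

lemma weak_eq_prod (hu : IsNonnegWeakSolution α (-1) p u₀ u) (hα : 0 < α) (hα2 : α ≤ 2)
    {T : ℝ} (hT : 0 < T) {φ : EuclideanSpace ℝ (Fin N) → ℝ} (hφ : ContDiff ℝ ∞ φ)
    (hs : HasCompactSupport φ) :
    ∫ x, u T x * φ x = (∫ x, u₀ x * φ x)
      - (∫ z : ℝ × EuclideanSpace ℝ (Fin N), u z.1 z.2 * fracLaplacian α φ z.2
          ∂((volume.restrict (Ioc 0 T)).prod volume))
      - ∫ z : ℝ × EuclideanSpace ℝ (Fin N), u z.1 z.2 ^ p * φ z.2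
          ∂((volume.restrict (Ioc 0 T)).prod volume) := by
  obtain ⟨C, hC⟩ := exists_abs_fracLaplacian_le α φ
  have h1 : Integrable (fun z : ℝ × EuclideanSpace ℝ (Fin N) =>
      u z.1 z.2 * fracLaplacian α φ z.2) ((volume.restrict (Ioc 0 T)).prod volume) :=
    (hu.integrable_prod hT).mul_bdd (c := C)
      ((continuous_fracLaplacian hα hα2 hφ hs).comp continuous_snd).aestronglyMeasurable
      (ae_of_all _ fun z => hC z.2)
  have h2 := hu.integrable_pow_mul hT hφ.continuous hs
  rw [hu.weak_eq φ hφ hs T hT, intervalIntegral.integral_of_le hT.le]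
  have h3 : Integrable (fun z : ℝ × EuclideanSpace ℝ (Fin N) =>
      -(u z.1 z.2 * fracLaplacian α φ z.2) + -1 * u z.1 z.2 ^ p * φ z.2)
      ((volume.restrict (Ioc 0 T)).prod volume) := by
    refine (h1.neg.sub h2).congr (ae_of_all _ fun z => ?_)
    simp only [Pi.sub_apply, Pi.neg_apply]
    ring
  rw [← integral_prod _ h3]
  have e : ∀ z : ℝ × EuclideanSpace ℝ (Fin N),
      -(u z.1 z.2 * fracLaplacian α φ z.2) + -1 * u z.1 z.2 ^ p * φ z.2
      = -(u z.1 z.2 * fracLaplacian α φ z.2) - u z.1 z.2 ^ p * φ z.2 := fun z => by ring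
  have hn : Integrable (fun z : ℝ × EuclideanSpace ℝ (Fin N) =>
      -(u z.1 z.2 * fracLaplacian α φ z.2)) ((volume.restrict (Ioc 0 T)).prod volume) := h1.neg
  simp_rw [e]
  rw [integral_sub hn h2, integral_neg]
  ring

/-- Testing with the cut-offs `χ(εx)` bounds `∬ u^p χ(εx)` by `∫ u₀ + B ∬ u`, where `B` bounds `Λ^α`
of the cut-offs uniformly in `ε`. Fatou's lemma upgrades local integrability to global. -/
lemma integrable_pow_prod (hu : IsNonnegWeakSolution α (-1) p u₀ u) (hα : 0 < α) (hα2 : α ≤ 2)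
    (hu₀ : Integrable u₀) (hu₀n : ∀ᵐ x, 0 ≤ u₀ x) {T : ℝ} (hT : 0 < T) :
    Integrable (fun z : ℝ × EuclideanSpace ℝ (Fin N) => u z.1 z.2 ^ p)
      ((volume.restrict (Ioc 0 T)).prod volume) := by
  let χ : ContDiffBump (0 : EuclideanSpace ℝ (Fin N)) := ⟨1, 2, one_pos, one_lt_two⟩
  have hχ : ContDiff ℝ ∞ χ := χ.contDiff
  have hs : HasCompactSupport χ := χ.hasCompactSupport
  have hχ0 : χ 0 = 1 := χ.one_of_mem_closedBall (by simp [χ])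
  set ε : ℕ → ℝ := fun n => 1 / ((n : ℝ) + 1) with hεdef
  have hε : ∀ n, 0 < ε n := fun n => by positivity
  have hε1 : ∀ n, ε n ≤ 1 := fun n => by
    rw [hεdef]
    exact (div_le_one (by positivity)).2 (by linarith [Nat.cast_nonneg (α := ℝ) n])
  -- Amplitude one and frequency zero give the plain cut-off, so the estimates for modulated
  -- functions apply.
  set φ : ℕ → EuclideanSpace ℝ (Fin N) → ℝ := fun n x => (modulated χ 1 0 (ε n) x).re with hφdef
  have hφ : ∀ n x, φ n x = χ (ε n • x) := fun n x => by
    simp [hφdef, modulated_re, planeWave]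
  have hφs : ∀ n, ContDiff ℝ ∞ (φ n) := fun n =>
    Complex.reCLM.contDiff.comp (contDiff_modulated hχ 1 0 (ε n))
  have hφc : ∀ n, HasCompactSupport (φ n) := fun n =>
    (hasCompactSupport_modulated hs 1 0 (hε n)).comp_left (g := Complex.re) (by simp)
  have hφ0 : ∀ n x, 0 ≤ φ n x := fun n x => by rw [hφ]; exact χ.nonneg
  have hφ1 : ∀ n x, φ n x ≤ 1 := fun n x => by rw [hφ]; exact χ.le_one
  set B := ∫ ζ, modulatedBound α χ 1 0 ζ with hB
  refine (integrable_and_integral_le_of_tendsto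
    (C := (∫ x, u₀ x) + ∫ z : ℝ × EuclideanSpace ℝ (Fin N), u z.1 z.2 * B
      ∂((volume.restrict (Ioc 0 T)).prod volume))
    (fun n => hu.integrable_pow_mul hT (hφs n).continuous (hφc n)) (fun n => ?_) (fun n => ?_)
    ?_).1
  · filter_upwards [hu.nonneg_prod hT] with z hz
    exact mul_nonneg (Real.rpow_nonneg hz _) (hφ0 n _)
  · have h := hu.weak_eq_prod hα hα2 hT (hφs n) (hφc n)
    have h1 : 0 ≤ ∫ x, u T x * φ n x := by
      refine integral_nonneg_of_ae ?_
      filter_upwards [hu.nonneg T hT] with x hx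
      exact mul_nonneg hx (hφ0 n x)
    have h2 : ∫ x, u₀ x * φ n x ≤ ∫ x, u₀ x := by
      refine integral_mono_of_nonneg ?_ hu₀ ?_
      · filter_upwards [hu₀n] with x hx
        exact mul_nonneg hx (hφ0 n x)
      · filter_upwards [hu₀n] with x hx
        exact mul_le_of_le_one_right hx (hφ1 n x)
    have h3 : |∫ z : ℝ × EuclideanSpace ℝ (Fin N), u z.1 z.2 * fracLaplacian α (φ n) z.2
        ∂((volume.restrict (Ioc 0 T)).prod volume)|
        ≤ ∫ z : ℝ × EuclideanSpace ℝ (Fin N), u z.1 z.2 * B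
          ∂((volume.restrict (Ioc 0 T)).prod volume) := by
      refine norm_integral_le_of_norm_le (f := fun z : ℝ × EuclideanSpace ℝ (Fin N) =>
        u z.1 z.2 * fracLaplacian α (φ n) z.2) ((hu.integrable_prod hT).mul_const B) ?_
      filter_upwards [hu.nonneg_prod hT] with z hz
      rw [norm_mul, Real.norm_of_nonneg hz]
      exact mul_le_mul_of_nonneg_left (abs_fracLaplacian_modulated_le hα hα2 hχ hs 1 0 z.2 (hε n)
        (hε1 n)) hz
    have := neg_abs_le (∫ z : ℝ × EuclideanSpace ℝ (Fin N), u z.1 z.2 * fracLaplacian α (φ n) z.2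
        ∂((volume.restrict (Ioc 0 T)).prod volume))
    linarith
  · refine ae_of_all _ fun z => ?_
    have hlim : Tendsto (fun n => φ n z.2) atTop (𝓝 1) := by
      simp_rw [hφ]
      have h := (hχ.continuous.tendsto 0).comp (by
        simpa using (tendsto_one_div_add_atTop_nhds_zero_nat (𝕜 := ℝ)).smul_const z.2)
      rw [hχ0] at h
      simpa [hεdef, Function.comp_def] using h
    simpa using hlim.const_mul (u z.1 z.2 ^ p)

/-- Modulated cut-offs are admissible and converge to the plane wave. Global integrability of `u ^
p` lets every term pass to the limit. -/
lemma weak_eq_re_planeWave (hu : IsNonnegWeakSolution α (-1) p u₀ u) (hα : 0 < α) (hα2 : α ≤ 2)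
    (hu₀ : Integrable u₀) (hu₀n : ∀ᵐ x, 0 ≤ u₀ x) {T : ℝ} (hT : 0 < T) (c : ℂ)
    (η : EuclideanSpace ℝ (Fin N)) :
    ∫ x, u T x * (c * planeWave η x).re = (∫ x, u₀ x * (c * planeWave η x).re)
      - (∫ z : ℝ × EuclideanSpace ℝ (Fin N),
          u z.1 z.2 * (stableSymbol α η * (c * planeWave η z.2).re)
          ∂((volume.restrict (Ioc 0 T)).prod volume))
      - ∫ z : ℝ × EuclideanSpace ℝ (Fin N), u z.1 z.2 ^ p * (c * planeWave η z.2).re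
          ∂((volume.restrict (Ioc 0 T)).prod volume) := by
  let χ : ContDiffBump (0 : EuclideanSpace ℝ (Fin N)) := ⟨1, 2, one_pos, one_lt_two⟩
  have hχ : ContDiff ℝ ∞ χ := χ.contDiff
  have hs : HasCompactSupport χ := χ.hasCompactSupport
  have hχ0 : χ 0 = 1 := χ.one_of_mem_closedBall (by simp [χ])
  set ε : ℕ → ℝ := fun n => 1 / ((n : ℝ) + 1) with hεdef
  have hε : ∀ n, 0 < ε n := fun n => by positivity
  have hε1 : ∀ n, ε n ≤ 1 := fun n => by
    rw [hεdef]
    exact (div_le_one (by positivity)).2 (by linarith [Nat.cast_nonneg (α := ℝ) n])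
  have hε0 : Tendsto ε atTop (𝓝 0) := tendsto_one_div_add_atTop_nhds_zero_nat
  set φ : ℕ → EuclideanSpace ℝ (Fin N) → ℝ := fun n x => (modulated χ c η (ε n) x).re with hφdef
  have hφs : ∀ n, ContDiff ℝ ∞ (φ n) := fun n =>
    Complex.reCLM.contDiff.comp (contDiff_modulated hχ c η (ε n))
  have hφc : ∀ n, HasCompactSupport (φ n) := fun n =>
    (hasCompactSupport_modulated hs c η (hε n)).comp_left (g := Complex.re) (by simp)
  have hφb : ∀ n x, ‖φ n x‖ ≤ ‖c‖ := fun n x => by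
    rw [hφdef]
    simp only
    rw [modulated_re, norm_mul, Real.norm_of_nonneg (χ.nonneg)]
    exact (mul_le_of_le_one_right (norm_nonneg _) χ.le_one).trans (abs_re_mul_planeWave_le c η x)
  have hφl : ∀ x, Tendsto (fun n => φ n x) atTop (𝓝 (c * planeWave η x).re) := fun x => by
    simp_rw [hφdef, modulated_re]
    have h : Tendsto (fun n => χ (ε n • x)) atTop (𝓝 1) := by
      rw [← hχ0]
      refine (hχ.continuous.tendsto 0).comp ?_
      simpa using hε0.smul_const x
    simpa using h.const_mul (c * planeWave η x).re
  have key : ∀ {X : Type _} [MeasurableSpace X] {μ : Measure X} {f : X → ℝ}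
      (_ : Integrable f μ) {G : ℕ → X → ℝ} {g : X → ℝ} {C : ℝ}
      (_ : ∀ n, AEStronglyMeasurable (G n) μ) (_ : ∀ n x, ‖G n x‖ ≤ C)
      (_ : ∀ x, Tendsto (fun n => G n x) atTop (𝓝 (g x))),
      Tendsto (fun n => ∫ x, f x * G n x ∂μ) atTop (𝓝 (∫ x, f x * g x ∂μ)) := by
    intro X _ μ f hf G g C hG hC hl
    refine tendsto_integral_of_dominated_convergence (fun x => ‖f x‖ * C)
      (fun n => hf.1.mul (hG n)) (hf.norm.mul_const C) (fun n => ae_of_all _ fun x => ?_)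
      (ae_of_all _ fun x => (hl x).const_mul _)
    rw [norm_mul]
    exact mul_le_mul_of_nonneg_left (hC n x) (norm_nonneg _)
  have l1 := key (hu.integrable_slice T hT)
    (fun n => (hφs n).continuous.aestronglyMeasurable) hφb hφl
  have l2 := key hu₀ (fun n => (hφs n).continuous.aestronglyMeasurable) hφb hφl
  have l3 := key (hu.integrable_prod hT) (G := fun n z => fracLaplacian α (φ n) z.2)
    (fun n => ((continuous_fracLaplacian hα hα2 (hφs n) (hφc n)).comp
      continuous_snd).aestronglyMeasurable)
    (fun n z => abs_fracLaplacian_modulated_le hα hα2 hχ hs c η z.2 (hε n) (hε1 n))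
    (fun z => tendsto_fracLaplacian_modulated hα hα2 hχ hs hχ0 c η z.2 hε hε1 hε0)
  have l4 := key (hu.integrable_pow_prod hα hα2 hu₀ hu₀n hT) (G := fun n z => φ n z.2)
    (fun n => ((hφs n).continuous.comp continuous_snd).aestronglyMeasurable)
    (fun n z => hφb n z.2) (fun z => hφl z.2)
  refine tendsto_nhds_unique l1 (((l2.sub l3).sub l4).congr fun n => ?_)
  exact (hu.weak_eq_prod hα hα2 hT (hφs n) (hφc n)).symm

lemma fourier_eq_prod (hu : IsNonnegWeakSolution α (-1) p u₀ u) (hα : 0 < α) (hα2 : α ≤ 2)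
    (hu₀ : Integrable u₀) (hu₀n : ∀ᵐ x, 0 ≤ u₀ x) {T : ℝ} (hT : 0 < T)
    (η : EuclideanSpace ℝ (Fin N)) :
    ∫ x, (u T x : ℂ) * planeWave η x = (∫ x, (u₀ x : ℂ) * planeWave η x)
      - stableSymbol α η * (∫ z : ℝ × EuclideanSpace ℝ (Fin N), (u z.1 z.2 : ℂ) * planeWave η z.2
          ∂((volume.restrict (Ioc 0 T)).prod volume))
      - ∫ z : ℝ × EuclideanSpace ℝ (Fin N), ((u z.1 z.2 ^ p : ℝ) : ℂ) * planeWave η z.2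
          ∂((volume.restrict (Ioc 0 T)).prod volume) := by
  set X := ∫ x, (u T x : ℂ) * planeWave η x with hX
  set Y := ∫ x, (u₀ x : ℂ) * planeWave η x with hY
  set Z := ∫ z : ℝ × EuclideanSpace ℝ (Fin N), (u z.1 z.2 : ℂ) * planeWave η z.2
          ∂((volume.restrict (Ioc 0 T)).prod volume) with hZ
  set W := ∫ z : ℝ × EuclideanSpace ℝ (Fin N), ((u z.1 z.2 ^ p : ℝ) : ℂ) * planeWave η z.2
          ∂((volume.restrict (Ioc 0 T)).prod volume) with hW
  have hm := (continuous_planeWave η).aestronglyMeasurable (μ := volume)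
  have hb := fun x => (norm_planeWave η x).le
  have hm2 : AEStronglyMeasurable (fun z : ℝ × EuclideanSpace ℝ (Fin N) => planeWave η z.2)
      ((volume.restrict (Ioc 0 T)).prod volume) :=
    ((continuous_planeWave η).comp continuous_snd).aestronglyMeasurable
  -- The amplitude is free: `c = 1` gives the real part of the identity and `c = -i` the imaginary
  -- part.
  have key : ∀ c : ℂ, (c * X).re = (c * Y).re - stableSymbol α η * (c * Z).re - (c * W).re := by
    intro c
    rw [hX, hY, hZ, hW, re_mul_integral_ofReal_mul (hu.integrable_slice T hT) hm hb,
      re_mul_integral_ofReal_mul hu₀ hm hb,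
      re_mul_integral_ofReal_mul (hu.integrable_prod hT) hm2 (fun z => hb z.2),
      re_mul_integral_ofReal_mul (hu.integrable_pow_prod hα hα2 hu₀ hu₀n hT) hm2
        (fun z => hb z.2),
      hu.weak_eq_re_planeWave hα hα2 hu₀ hu₀n hT, ← integral_const_mul]
    congr 3
    ext z
    ring
  have k1 := key 1
  have k2 := key (-Complex.I)
  simp only [one_mul, neg_mul, Complex.neg_re, Complex.I_mul_re, neg_neg] at k1 k2
  apply Complex.ext
  · simp [k1]
  · simp [k2]

/-- For each frequency, the Fourier transform of a weak solution solves the integrated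
ordinary differential equation. -/
lemma fourier_eq (hu : IsNonnegWeakSolution α (-1) p u₀ u) (hα : 0 < α) (hα2 : α ≤ 2)
    (hu₀ : Integrable u₀) (hu₀n : ∀ᵐ x, 0 ≤ u₀ x) (ξ : EuclideanSpace ℝ (Fin N)) {T : ℝ}
    (hT : 0 < T) :
    IntegrableOn (fun s => 𝓕 (fun x => (u s x : ℂ)) ξ) (Ioc 0 T) ∧
    IntegrableOn (fun s => 𝓕 (fun x => ((u s x ^ p : ℝ) : ℂ)) ξ) (Ioc 0 T) ∧
    𝓕 (fun x => (u T x : ℂ)) ξ = 𝓕 (fun x => (u₀ x : ℂ)) ξ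
      - ∫ s in Ioc 0 T, (stableSymbol α ξ * 𝓕 (fun x => (u s x : ℂ)) ξ
          + 𝓕 (fun x => ((u s x ^ p : ℝ) : ℂ)) ξ) := by
  have hm2 := ((continuous_planeWave (-ξ)).comp continuous_snd).aestronglyMeasurable
    (μ := (volume.restrict (Ioc 0 T)).prod volume)
  have i1 : Integrable (fun z : ℝ × EuclideanSpace ℝ (Fin N) =>
      (u z.1 z.2 : ℂ) * planeWave (-ξ) z.2) ((volume.restrict (Ioc 0 T)).prod volume) :=
    (hu.integrable_prod hT).ofReal.mul_bdd (c := 1) hm2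
      (ae_of_all _ fun z => (norm_planeWave _ _).le)
  have i2 : Integrable (fun z : ℝ × EuclideanSpace ℝ (Fin N) =>
      ((u z.1 z.2 ^ p : ℝ) : ℂ) * planeWave (-ξ) z.2)
      ((volume.restrict (Ioc 0 T)).prod volume) :=
    (hu.integrable_pow_prod hα hα2 hu₀ hu₀n hT).ofReal.mul_bdd (c := 1) hm2
      (ae_of_all _ fun z => (norm_planeWave _ _).le)
  have e1 : ∀ s, 𝓕 (fun x => (u s x : ℂ)) ξ = ∫ x, (u s x : ℂ) * planeWave (-ξ) x :=
    fun s => fourier_eq_integral_planeWave _ ξ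
  have e2 : ∀ s, 𝓕 (fun x => ((u s x ^ p : ℝ) : ℂ)) ξ
      = ∫ x, ((u s x ^ p : ℝ) : ℂ) * planeWave (-ξ) x :=
    fun s => fourier_eq_integral_planeWave (fun x => u s x ^ p) ξ
  simp_rw [e1, e2, fourier_eq_integral_planeWave u₀]
  have j1 := i1.integral_prod_left
  have j2 := i2.integral_prod_left
  refine ⟨j1, j2, ?_⟩
  rw [integral_add (j1.const_mul _) j2, integral_const_mul,
    hu.fourier_eq_prod hα hα2 hu₀ hu₀n hT, integral_prod _ i1, integral_prod _ i2,
    stableSymbol_neg]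
  ring

end IsNonnegWeakSolution

end WeakSolution

/-! ### Variation of constants for integrated equations -/

section Duhamel

/-- Fubini on the triangle `σ ≤ τ`. It replaces integration by parts, since `h` is merely
integrable. -/
lemma setIntegral_mul_primitive {k K : ℝ → ℝ} (hK : ∀ τ, HasDerivAt K (k τ) τ) (hk : Continuous k)
    {s t : ℝ} {h : ℝ → ℂ} (hh : IntegrableOn h (Ioc s t)) :
    ∫ τ in Ioc s t, (k τ : ℂ) * ∫ σ in Ioc s τ, h σ
      = ∫ σ in Ioc s t, ((K t - K σ : ℝ) : ℂ) * h σ := by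
  have hki : IntegrableOn (fun τ => (k τ : ℂ)) (Ioc s t) :=
    ((Complex.continuous_ofReal.comp hk).integrableOn_Icc (a := s) (b := t)).mono_set
      Ioc_subset_Icc_self
  have hprod : Integrable (Function.uncurry fun τ σ : ℝ =>
      {z : ℝ × ℝ | z.2 ≤ z.1}.indicator (fun z => (k z.1 : ℂ) * h z.2) (τ, σ))
      ((volume.restrict (Ioc s t)).prod (volume.restrict (Ioc s t))) :=
    (hki.mul_prod hh).indicator (measurableSet_le measurable_snd measurable_fst)
  calc ∫ τ in Ioc s t, (k τ : ℂ) * ∫ σ in Ioc s τ, h σ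
      = ∫ τ in Ioc s t, ∫ σ in Ioc s t,
          {z : ℝ × ℝ | z.2 ≤ z.1}.indicator (fun z => (k z.1 : ℂ) * h z.2) (τ, σ) := by
        refine setIntegral_congr_fun measurableSet_Ioc fun τ hτ => ?_
        have e : ∀ σ, {z : ℝ × ℝ | z.2 ≤ z.1}.indicator (fun z => (k z.1 : ℂ) * h z.2) (τ, σ)
            = (Iic τ).indicator (fun σ => (k τ : ℂ) * h σ) σ := fun σ => by
          by_cases hσ : σ ≤ τ <;> simp [indicator, hσ]
        simp_rw [e]
        rw [setIntegral_indicator measurableSet_Iic, integral_const_mul]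
        congr 3
        ext σ
        simp only [mem_Ioc, mem_inter_iff, mem_Iic]
        exact ⟨fun hσ => ⟨⟨hσ.1, hσ.2.trans hτ.2⟩, hσ.2⟩, fun hσ => ⟨hσ.1.1, hσ.2⟩⟩
    _ = ∫ σ in Ioc s t, ∫ τ in Ioc s t,
          {z : ℝ × ℝ | z.2 ≤ z.1}.indicator (fun z => (k z.1 : ℂ) * h z.2) (τ, σ) :=
        integral_integral_swap hprod
    _ = ∫ σ in Ioc s t, ((K t - K σ : ℝ) : ℂ) * h σ := by
        refine setIntegral_congr_fun measurableSet_Ioc fun σ hσ => ?_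
        have e : ∀ τ, {z : ℝ × ℝ | z.2 ≤ z.1}.indicator (fun z => (k z.1 : ℂ) * h z.2) (τ, σ)
            = (Ici σ).indicator (fun τ => (k τ : ℂ) * h σ) τ := fun τ => by
          by_cases hτ : σ ≤ τ <;> simp [indicator, hτ]
        simp_rw [e]
        rw [setIntegral_indicator measurableSet_Ici, integral_mul_const, integral_complex_ofReal]
        have e2 : Ioc s t ∩ Ici σ = Icc σ t := by
          ext τ
          simp only [mem_Ioc, mem_inter_iff, mem_Ici, mem_Icc]
          exact ⟨fun hτ => ⟨hτ.2, hτ.1.2⟩, fun hτ => ⟨⟨hσ.1.trans_le hτ.1, hτ.2⟩, hτ.1⟩⟩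
        rw [e2, integral_Icc_eq_integral_Ioc, ← intervalIntegral.integral_of_le hσ.2,
          intervalIntegral.integral_eq_sub_of_hasDerivAt (fun τ _ => hK τ)
            (hk.intervalIntegrable _ _)]

/-- Variation of constants for the integrated equation `y' = -(a y + f)` with integrable `f`. -/
lemma variation_of_constants {y f : ℝ → ℂ} {a s t : ℝ} (hst : s < t)
    (hy : IntegrableOn y (Ioc s t)) (hf : IntegrableOn f (Ioc s t))
    (heq : ∀ τ ∈ Ioc s t, y τ = y s - ∫ σ in Ioc s τ, (a * y σ + f σ)) :
    y t = (Real.exp (-((t - s) * a)) : ℝ) * y s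
      - ∫ τ in Ioc s t, (Real.exp (-((t - τ) * a)) : ℝ) * f τ := by
  have hK : ∀ τ, HasDerivAt (fun τ => Real.exp (a * τ)) (a * Real.exp (a * τ)) τ := fun τ => by
    simpa [mul_comm] using ((hasDerivAt_id τ).const_mul a).exp
  have hbdd : ∀ {g : ℝ → ℝ}, Continuous g → ∀ {w : ℝ → ℂ}, IntegrableOn w (Ioc s t) →
      IntegrableOn (fun τ => (g τ : ℂ) * w τ) (Ioc s t) := by
    intro g hg w hw
    obtain ⟨C, hC⟩ := (isCompact_Icc (a := s) (b := t)).exists_bound_of_continuousOn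
      hg.continuousOn
    refine Integrable.bdd_mul (c := C) hw
      (Complex.continuous_ofReal.comp hg).aestronglyMeasurable ?_
    filter_upwards [ae_restrict_mem measurableSet_Ioc] with τ hτ
    rw [Complex.norm_real]
    exact hC τ (Ioc_subset_Icc_self hτ)
  -- The integrating factor is `e^{aτ}`. By the equation the primitive of `a y + f` is `y s - y τ`,
  -- so `∫ a e^{aτ} y` occurs on both sides and cancels.
  have h := setIntegral_mul_primitive hK (by fun_prop) ((hy.const_mul (a : ℂ)).add hf)
  have hky := hbdd (g := fun τ => a * Real.exp (a * τ)) (by fun_prop) hy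
  have hKf := hbdd (g := fun τ => Real.exp (a * τ)) (by fun_prop) hf
  have hKh := hbdd (g := fun τ => Real.exp (a * τ)) (by fun_prop)
    ((hy.const_mul (a : ℂ)).add hf)
  have hkc : IntegrableOn (fun τ => ((a * Real.exp (a * τ) : ℝ) : ℂ) * y s) (Ioc s t) :=
    hbdd (by fun_prop) (integrableOn_const (by simp))
  have hL : ∫ τ in Ioc s t, ((a * Real.exp (a * τ) : ℝ) : ℂ) *
        ∫ σ in Ioc s τ, ((fun σ => (a : ℂ) * y σ) + f) σ
      = ((Real.exp (a * t) - Real.exp (a * s) : ℝ) : ℂ) * y s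
        - ∫ τ in Ioc s t, ((a * Real.exp (a * τ) : ℝ) : ℂ) * y τ := by
    have e : ∀ τ ∈ Ioc s t, ((a * Real.exp (a * τ) : ℝ) : ℂ) *
        ∫ σ in Ioc s τ, ((fun σ => (a : ℂ) * y σ) + f) σ
        = ((a * Real.exp (a * τ) : ℝ) : ℂ) * y s - ((a * Real.exp (a * τ) : ℝ) : ℂ) * y τ := by
      intro τ hτ
      rw [heq τ hτ]
      simp only [Pi.add_apply]
      ring
    rw [setIntegral_congr_fun measurableSet_Ioc e, integral_sub hkc hky, integral_mul_const,
      integral_complex_ofReal, ← intervalIntegral.integral_of_le hst.le,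
      intervalIntegral.integral_eq_sub_of_hasDerivAt (fun τ _ => hK τ)
        (Continuous.intervalIntegrable (by fun_prop) _ _)]
  have hR : ∫ σ in Ioc s t, ((Real.exp (a * t) - Real.exp (a * σ) : ℝ) : ℂ) *
        ((fun σ => (a : ℂ) * y σ) + f) σ
      = (Real.exp (a * t) : ℝ) * (y s - y t)
        - (∫ τ in Ioc s t, ((a * Real.exp (a * τ) : ℝ) : ℂ) * y τ)
        - ∫ τ in Ioc s t, (Real.exp (a * τ) : ℝ) * f τ := by
    have e : ∀ σ, ((Real.exp (a * t) - Real.exp (a * σ) : ℝ) : ℂ) *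
        ((fun σ => (a : ℂ) * y σ) + f) σ
        = (Real.exp (a * t) : ℝ) * ((fun σ => (a : ℂ) * y σ) + f) σ
          - (Real.exp (a * σ) : ℝ) * ((fun σ => (a : ℂ) * y σ) + f) σ := fun σ => by
      push_cast; ring
    have e2 : ∀ σ, ((Real.exp (a * σ) : ℝ) : ℂ) * ((fun σ => (a : ℂ) * y σ) + f) σ
        = ((a * Real.exp (a * σ) : ℝ) : ℂ) * y σ + (Real.exp (a * σ) : ℝ) * f σ := fun σ => by
      simp only [Pi.add_apply]; push_cast; ring
    simp_rw [e]
    rw [integral_sub (((hy.const_mul (a : ℂ)).add hf).const_mul _) hKh, integral_const_mul]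
    simp_rw [e2]
    rw [integral_add hky hKf, heq t ⟨hst, le_rfl⟩]
    simp only [Pi.add_apply]
    ring
  rw [hL, hR] at h
  have hmain : (Real.exp (a * t) : ℝ) * y t = (Real.exp (a * s) : ℝ) * y s
      - ∫ τ in Ioc s t, (Real.exp (a * τ) : ℝ) * f τ := by
    push_cast at h ⊢
    linear_combination h
  have e0 : ((Real.exp (-(a * t)) : ℝ) : ℂ) * (Real.exp (a * t) : ℝ) = 1 := by
    rw [← Complex.ofReal_mul, ← Real.exp_add]; simp
  have e1 : ∀ τ, ((Real.exp (-((t - τ) * a)) : ℝ) : ℂ)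
      = (Real.exp (-(a * t)) : ℝ) * (Real.exp (a * τ) : ℝ) := fun τ => by
    rw [← Complex.ofReal_mul, ← Real.exp_add]
    congr 2
    ring
  simp_rw [e1, mul_assoc]
  rw [integral_const_mul]
  linear_combination ((Real.exp (-(a * t)) : ℝ) : ℂ) * hmain - y t * e0

end Duhamel

/-! ### Duhamel's formula in weak form and comparison with the linear flow -/

section Comparison

variable {N : ℕ} {α p : ℝ} {u₀ : EuclideanSpace ℝ (Fin N) → ℝ}
  {u : ℝ → EuclideanSpace ℝ (Fin N) → ℝ}

lemma integrable_fourierInv {Φ : EuclideanSpace ℝ (Fin N) → ℂ}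
    (hΦ : ContDiff ℝ ∞ Φ) (hs : HasCompactSupport Φ) : Integrable (𝓕⁻ Φ) := by
  refine (integrable_fourier hΦ hs).comp_neg.congr (ae_of_all _ fun x => ?_)
  rw [Real.fourierInv_eq_fourier_neg]

/-- The transform of an `L¹` function need not be integrable, so the return to physical space goes
through pairing with a test function. -/
lemma integral_fourier_mul_fourierInv {f ψ : EuclideanSpace ℝ (Fin N) → ℝ} (hf : Integrable f)
    (hψ : ContDiff ℝ ∞ ψ) (hs : HasCompactSupport ψ) :
    ∫ ξ, 𝓕 (fun x => (f x : ℂ)) ξ * 𝓕⁻ (fun x => (ψ x : ℂ)) ξ = ((∫ x, f x * ψ x : ℝ) : ℂ) := by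
  have hψ' : ContDiff ℝ ∞ fun x => (ψ x : ℂ) := Complex.ofRealCLM.contDiff.comp hψ
  have hs' : HasCompactSupport fun x => (ψ x : ℂ) :=
    hs.comp_left (g := fun z : ℝ => (z : ℂ)) (by simp)
  have h := integral_fourier_mul_eq_of_integrable (f := fun x => (f x : ℂ)) hf.ofReal
    (integrable_fourierInv hψ' hs')
  rw [h, hψ'.continuous.fourier_fourierInv_eq (integrable_of_contDiff_hasCompactSupport hψ' hs')
      (integrable_fourier hψ' hs'), ← integral_complex_ofReal]
  congr 1
  ext x
  push_cast
  rfl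

lemma integral_fourier_mul_exp_mul_fourierInv (hα : 0 < α) (hα2 : α ≤ 2) {t : ℝ} (ht : 0 < t)
    {f ψ : EuclideanSpace ℝ (Fin N) → ℝ} (hf : Integrable f) (hψ : ContDiff ℝ ∞ ψ)
    (hs : HasCompactSupport ψ) :
    ∫ ξ, (Real.exp (-(t * stableSymbol α ξ)) : ℝ) * 𝓕 (fun x => (f x : ℂ)) ξ *
      𝓕⁻ (fun x => (ψ x : ℂ)) ξ = ((∫ x, heatConv α t f x * ψ x : ℝ) : ℂ) := by
  rw [← integral_fourier_mul_fourierInv (integrable_heatConv hα hα2 ht hf) hψ hs]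
  congr 1
  ext ξ
  rw [fourier_heatConv hα hα2 ht hf, mul_comm (𝓕 (fun x => (f x : ℂ)) ξ)]

namespace IsNonnegWeakSolution

lemma integrable_pow_prod_Ioc (hu : IsNonnegWeakSolution α (-1) p u₀ u) (hα : 0 < α)
    (hα2 : α ≤ 2) (hu₀ : Integrable u₀) (hu₀n : ∀ᵐ x, 0 ≤ u₀ x) {s t : ℝ} (hs : 0 < s)
    (hst : s < t) :
    Integrable (fun z : ℝ × EuclideanSpace ℝ (Fin N) => u z.1 z.2 ^ p)
      ((volume.restrict (Ioc s t)).prod volume) :=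
  (hu.integrable_pow_prod hα hα2 hu₀ hu₀n (hs.trans hst)).mono_measure
    (Measure.prod_mono (Measure.restrict_mono (Ioc_subset_Ioc_left hs.le) le_rfl) le_rfl)

lemma fourier_duhamel (hu : IsNonnegWeakSolution α (-1) p u₀ u) (hα : 0 < α) (hα2 : α ≤ 2)
    (hu₀ : Integrable u₀) (hu₀n : ∀ᵐ x, 0 ≤ u₀ x) {s t : ℝ} (hs : 0 < s) (hst : s < t)
    (ξ : EuclideanSpace ℝ (Fin N)) :
    𝓕 (fun x => (u t x : ℂ)) ξ
      = (Real.exp (-((t - s) * stableSymbol α ξ)) : ℝ) * 𝓕 (fun x => (u s x : ℂ)) ξ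
        - ∫ τ in Ioc s t, (Real.exp (-((t - τ) * stableSymbol α ξ)) : ℝ) *
            𝓕 (fun x => ((u τ x ^ p : ℝ) : ℂ)) ξ := by
  obtain ⟨i1, i2, -⟩ := hu.fourier_eq hα hα2 hu₀ hu₀n ξ (hs.trans hst)
  refine variation_of_constants (y := fun τ => 𝓕 (fun x => (u τ x : ℂ)) ξ)
    (f := fun τ => 𝓕 (fun x => ((u τ x ^ p : ℝ) : ℂ)) ξ) hst
    (i1.mono_set (Ioc_subset_Ioc_left hs.le)) (i2.mono_set (Ioc_subset_Ioc_left hs.le))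
    fun τ hτ => ?_
  obtain ⟨j1, j2, j3⟩ := hu.fourier_eq hα hα2 hu₀ hu₀n ξ (hs.trans hτ.1)
  obtain ⟨-, -, k3⟩ := hu.fourier_eq hα hα2 hu₀ hu₀n ξ hs
  have hi : IntegrableOn (fun σ => stableSymbol α ξ * 𝓕 (fun x => (u σ x : ℂ)) ξ
      + 𝓕 (fun x => ((u σ x ^ p : ℝ) : ℂ)) ξ) (Ioc 0 τ) := (j1.const_mul _).add j2
  have hsplit := setIntegral_union (Ioc_disjoint_Ioc_of_le le_rfl) measurableSet_Ioc
    (hi.mono_set (Ioc_subset_Ioc_right hτ.1.le)) (hi.mono_set (Ioc_subset_Ioc_left hs.le))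
  rw [Ioc_union_Ioc_eq_Ioc hs.le hτ.1.le] at hsplit
  rw [j3, k3, hsplit]
  ring

/-- This justifies exchanging the time and frequency integrals; the majorant is `‖Ψ ξ‖` times the
`L¹` norm of `u(τ)^p`. -/
lemma integrable_fourier_pow_mul (hu : IsNonnegWeakSolution α (-1) p u₀ u) (hα : 0 < α)
    (hα2 : α ≤ 2) (hu₀ : Integrable u₀) (hu₀n : ∀ᵐ x, 0 ≤ u₀ x) {s t : ℝ} (hs : 0 < s)
    (hst : s < t) {Ψ : EuclideanSpace ℝ (Fin N) → ℂ} (hΨ : Integrable Ψ) :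
    Integrable (Function.uncurry fun (ξ : EuclideanSpace ℝ (Fin N)) (τ : ℝ) =>
      (Real.exp (-((t - τ) * stableSymbol α ξ)) : ℝ) *
        𝓕 (fun x => ((u τ x ^ p : ℝ) : ℂ)) ξ * Ψ ξ)
      (volume.prod (volume.restrict (Ioc s t))) := by
  have hg := hu.integrable_pow_prod_Ioc hα hα2 hu₀ hu₀n hs hst
  have hm := hg.norm.integral_prod_left
  have hc := continuous_stableSymbol (V := EuclideanSpace ℝ (Fin N)) hα.le
  have hF : AEStronglyMeasurable (fun z : EuclideanSpace ℝ (Fin N) × ℝ =>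
      𝓕 (fun x => ((u z.2 x ^ p : ℝ) : ℂ)) z.1) (volume.prod (volume.restrict (Ioc s t))) := by
    -- Joint measurability in `(ξ, τ)` comes from viewing the transform as a parametric integral
    -- over `x`.
    have h1 : AEStronglyMeasurable
        (fun w : (EuclideanSpace ℝ (Fin N) × ℝ) × EuclideanSpace ℝ (Fin N) =>
          ((u w.1.2 w.2 ^ p : ℝ) : ℂ) * planeWave (-w.1.1) w.2)
        ((volume.prod (volume.restrict (Ioc s t))).prod volume) := by
      refine AEStronglyMeasurable.mul ?_ (Continuous.aestronglyMeasurable ?_)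
      · exact Complex.continuous_ofReal.comp_aestronglyMeasurable
          (hg.1.comp_quasiMeasurePreserving (QuasiMeasurePreserving.prodMap
            Measure.quasiMeasurePreserving_snd (Measure.QuasiMeasurePreserving.id _)))
      · unfold planeWave
        fun_prop
    refine h1.integral_prod_right'.congr (ae_of_all _ fun z => ?_)
    exact (fourier_eq_integral_planeWave (fun x => u z.2 x ^ p) z.1).symm
  refine (hΨ.norm.mul_prod hm).mono' ?_ ?_
  · refine AEStronglyMeasurable.mul (AEStronglyMeasurable.mul ?_ hF) hΨ.1.comp_fst
    exact Continuous.aestronglyMeasurable (by fun_prop)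
  · have : ∀ᵐ z : EuclideanSpace ℝ (Fin N) × ℝ ∂(volume.prod (volume.restrict (Ioc s t))),
        z.2 ∈ Ioc s t :=
      Measure.quasiMeasurePreserving_snd.ae (ae_restrict_mem measurableSet_Ioc)
    filter_upwards [this] with z hz
    simp only [Function.uncurry]
    rw [norm_mul, norm_mul, Complex.norm_real, Real.norm_eq_abs, Real.abs_exp, mul_comm]
    refine mul_le_mul_of_nonneg_left ?_ (norm_nonneg _)
    have h1 := exp_neg_mul_stableSymbol_le_one α (sub_nonneg.2 hz.2) z.1
    have h2 : ‖𝓕 (fun x => ((u z.2 x ^ p : ℝ) : ℂ)) z.1‖ ≤ ∫ x, ‖u z.2 x ^ p‖ := by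
      refine (VectorFourier.norm_fourierIntegral_le_integral_norm _ _ _ _ _).trans_eq ?_
      simp only [Complex.norm_real]
    exact (mul_le_of_le_one_left (norm_nonneg _) h1).trans h2

/-- Duhamel's formula paired with `ψ ≥ 0`: the subtracted term is nonnegative because the kernel and
`u ^ p` are. -/
lemma integral_mul_le_heatConv (hu : IsNonnegWeakSolution α (-1) p u₀ u) (hα : 0 < α)
    (hα2 : α ≤ 2) (hu₀ : Integrable u₀) (hu₀n : ∀ᵐ x, 0 ≤ u₀ x) {s t : ℝ} (hs : 0 < s)
    (hst : s < t) {ψ : EuclideanSpace ℝ (Fin N) → ℝ} (hψ : ContDiff ℝ ∞ ψ)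
    (hψs : HasCompactSupport ψ) (hψ0 : ∀ x, 0 ≤ ψ x) :
    ∫ x, u t x * ψ x ≤ ∫ x, heatConv α (t - s) (u s) x * ψ x := by
  have hψ' : ContDiff ℝ ∞ fun x => (ψ x : ℂ) := Complex.ofRealCLM.contDiff.comp hψ
  have hψs' : HasCompactSupport fun x => (ψ x : ℂ) :=
    hψs.comp_left (g := fun z : ℝ => (z : ℂ)) (by simp)
  have hΨ := integrable_fourierInv hψ' hψs'
  have hsw := hu.integrable_fourier_pow_mul hα hα2 hu₀ hu₀n hs hst hΨ
  have hg := hu.integrable_pow_prod_Ioc hα hα2 hu₀ hu₀n hs hst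
  have hus := hu.integrable_slice s hs
  have hA : Integrable fun ξ => (Real.exp (-((t - s) * stableSymbol α ξ)) : ℝ) *
      𝓕 (fun x => (u s x : ℂ)) ξ * 𝓕⁻ (fun x => (ψ x : ℂ)) ξ := by
    have hh := integrable_heatConv hα hα2 (sub_pos.2 hst) hus
    have hFc : Continuous (𝓕 (fun x => (heatConv α (t - s) (u s) x : ℂ))) :=
      VectorFourier.fourierIntegral_continuous Real.continuous_fourierChar
        (by exact continuous_inner) hh.ofReal
    have := hΨ.bdd_mul (c := ∫ x, ‖(heatConv α (t - s) (u s) x : ℂ)‖) hFc.aestronglyMeasurable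
      (ae_of_all _ fun ξ => VectorFourier.norm_fourierIntegral_le_integral_norm _ _ _ _ _)
    refine this.congr (ae_of_all _ fun ξ => ?_)
    simp only [fourier_heatConv hα hα2 (sub_pos.2 hst) hus]
    ring
  have hB := hsw.integral_prod_left
  simp only [Function.uncurry] at hB
  have key : ((∫ x, u t x * ψ x : ℝ) : ℂ)
      = ((∫ x, heatConv α (t - s) (u s) x * ψ x : ℝ) : ℂ)
        - ((∫ τ in Ioc s t, ∫ x, heatConv α (t - τ) (fun x => u τ x ^ p) x * ψ x : ℝ) : ℂ) := by
    rw [← integral_fourier_mul_fourierInv (hu.integrable_slice t (hs.trans hst)) hψ hψs,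
      ← integral_fourier_mul_exp_mul_fourierInv hα hα2 (sub_pos.2 hst) hus hψ hψs]
    have e : ∀ ξ, 𝓕 (fun x => (u t x : ℂ)) ξ * 𝓕⁻ (fun x => (ψ x : ℂ)) ξ
        = (Real.exp (-((t - s) * stableSymbol α ξ)) : ℝ) *
            𝓕 (fun x => (u s x : ℂ)) ξ * 𝓕⁻ (fun x => (ψ x : ℂ)) ξ
          - ∫ τ in Ioc s t, (Real.exp (-((t - τ) * stableSymbol α ξ)) : ℝ) *
            𝓕 (fun x => ((u τ x ^ p : ℝ) : ℂ)) ξ * 𝓕⁻ (fun x => (ψ x : ℂ)) ξ := fun ξ => by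
      rw [hu.fourier_duhamel hα hα2 hu₀ hu₀n hs hst, sub_mul, integral_mul_const]
    simp_rw [e]
    rw [integral_sub hA hB, integral_integral_swap hsw, ← integral_complex_ofReal]
    congr 1
    refine integral_congr_ae ?_
    -- The endpoint `τ = t` is discarded as a null set, since the convolution representation needs
    -- `t - τ > 0`.
    filter_upwards [hg.prod_right_ae, ae_restrict_mem measurableSet_Ioc,
      Measure.ae_ne (volume.restrict (Ioc s t)) t] with τ h1 h2 h3
    exact integral_fourier_mul_exp_mul_fourierInv hα hα2 (sub_pos.2 (lt_of_le_of_ne h2.2 h3))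
      h1 hψ hψs
  have key' : ∫ x, u t x * ψ x = (∫ x, heatConv α (t - s) (u s) x * ψ x)
      - ∫ τ in Ioc s t, ∫ x, heatConv α (t - τ) (fun x => u τ x ^ p) x * ψ x := by
    exact_mod_cast key
  rw [key']
  refine sub_le_self _ (integral_nonneg_of_ae ?_)
  filter_upwards [ae_restrict_mem measurableSet_Ioc,
    Measure.ae_ne (volume.restrict (Ioc s t)) t] with τ h2 h3
  refine integral_nonneg fun x => mul_nonneg (heatConv_nonneg hα hα2
    (sub_pos.2 (lt_of_le_of_ne h2.2 h3)) ?_ x) (hψ0 x)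
  filter_upwards [hu.nonneg τ (hs.trans h2.1)] with x hx
  exact Real.rpow_nonneg hx p

end IsNonnegWeakSolution

/-- Translated normalised bumps are admissible test functions, and the resulting mollifications
converge almost everywhere by Lebesgue differentiation. -/
lemma ae_le_of_forall_integral_mul_le {f g : EuclideanSpace ℝ (Fin N) → ℝ} (hf : Integrable f)
    (hg : Integrable g)
    (h : ∀ ψ : EuclideanSpace ℝ (Fin N) → ℝ, ContDiff ℝ ∞ ψ → HasCompactSupport ψ →
      (∀ x, 0 ≤ ψ x) → ∫ x, f x * ψ x ≤ ∫ x, g x * ψ x) : ∀ᵐ x, f x ≤ g x := by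
  -- The outer radius is twice the inner one: a bounded ratio is what the differentiation theorem
  -- requires.
  let φ : ℕ → ContDiffBump (0 : EuclideanSpace ℝ (Fin N)) := fun n =>
    ⟨1 / ((n : ℝ) + 1), 2 * (1 / ((n : ℝ) + 1)), by positivity, by
      have : 0 < 1 / ((n : ℝ) + 1) := by positivity
      linarith⟩
  have hr : Tendsto (fun n => (φ n).rOut) atTop (𝓝 0) := by
    have := (tendsto_one_div_add_atTop_nhds_zero_nat (𝕜 := ℝ)).const_mul 2
    rwa [mul_zero] at this
  have hK : ∀ᶠ n in atTop, (φ n).rOut ≤ 2 * (φ n).rIn := Eventually.of_forall fun n => le_rfl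
  filter_upwards [ContDiffBump.ae_convolution_tendsto_right_of_locallyIntegrable hr hK
      hf.locallyIntegrable,
    ContDiffBump.ae_convolution_tendsto_right_of_locallyIntegrable hr hK
      hg.locallyIntegrable] with x hx1 hx2
  refine le_of_tendsto_of_tendsto' hx1 hx2 fun n => ?_
  have h1 := h (fun y => (φ n).normed volume (x - y))
    ((φ n).contDiff_normed.comp (contDiff_const.sub contDiff_id))
    ((φ n).hasCompactSupport_normed.comp_homeomorph (Homeomorph.subLeft x))
    (fun y => (φ n).nonneg_normed _)
  rw [convolution_eq_swap, convolution_eq_swap]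
  simpa [mul_comm] using h1

lemma IsNonnegWeakSolution.ae_le_heatConv (hu : IsNonnegWeakSolution α (-1) p u₀ u) (hα : 0 < α)
    (hα2 : α ≤ 2) (hu₀ : Integrable u₀) (hu₀n : ∀ᵐ x, 0 ≤ u₀ x) {s t : ℝ} (hs : 0 < s)
    (hst : s < t) : ∀ᵐ x, u t x ≤ heatConv α (t - s) (u s) x :=
  ae_le_of_forall_integral_mul_le (hu.integrable_slice t (hs.trans hst))
    (integrable_heatConv hα hα2 (sub_pos.2 hst) (hu.integrable_slice s hs))
    fun _ hψ hψs hψ0 => hu.integral_mul_le_heatConv hα hα2 hu₀ hu₀n hs hst hψ hψs hψ0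

end Comparison

/-! ### Mass balance, survival of mass and the `L¹` profile -/

section Asymptotics

/-- Interpolation from `|f|^q ≤ B^{q-1} |f|`. -/
lemma eLpNorm_le_of_ae_bound_of_integrable {X : Type*} [MeasurableSpace X] {μ : Measure X}
    {f : X → ℝ} (hf : Integrable f μ) {B q : ℝ} (hB : 0 ≤ B) (hq : 1 ≤ q)
    (hfB : ∀ᵐ x ∂μ, |f x| ≤ B) :
    eLpNorm f (ENNReal.ofReal q) μ
      ≤ ENNReal.ofReal (B ^ (1 - 1 / q) * (∫ x, |f x| ∂μ) ^ (1 / q)) := by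
  have hq0 : 0 < q := zero_lt_one.trans_le hq
  have hI : 0 ≤ ∫ x, |f x| ∂μ := integral_nonneg fun x => abs_nonneg _
  rw [eLpNorm_eq_lintegral_rpow_enorm_toReal (ENNReal.ofReal_pos.2 hq0).ne' ENNReal.ofReal_ne_top,
    ENNReal.toReal_ofReal hq0.le]
  have h1 : ∫⁻ x, ‖f x‖ₑ ^ q ∂μ ≤ ENNReal.ofReal (B ^ (q - 1) * ∫ x, |f x| ∂μ) := by
    rw [← integral_const_mul, ofReal_integral_eq_lintegral_ofReal (hf.abs.const_mul _)
      (ae_of_all _ fun x => by positivity)]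
    refine lintegral_mono_ae ?_
    filter_upwards [hfB] with x hx
    rw [← ofReal_norm, ENNReal.ofReal_rpow_of_nonneg (norm_nonneg _) hq0.le]
    refine ENNReal.ofReal_le_ofReal ?_
    have : ‖f x‖ ^ q = ‖f x‖ ^ (q - 1) * ‖f x‖ := by
      rw [← Real.rpow_add_one' (norm_nonneg _) (by simpa using hq0.ne'), sub_add_cancel]
    rw [this]
    exact mul_le_mul_of_nonneg_right (Real.rpow_le_rpow (norm_nonneg _) hx (by linarith))
      (norm_nonneg _)
  refine (ENNReal.rpow_le_rpow h1 (by positivity)).trans_eq ?_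
  rw [ENNReal.ofReal_rpow_of_nonneg (by positivity) (by positivity),
    Real.mul_rpow (by positivity) hI, ← Real.rpow_mul hB]
  congr 3
  field_simp

variable {N : ℕ} {α p : ℝ} {u₀ : EuclideanSpace ℝ (Fin N) → ℝ}
  {u : ℝ → EuclideanSpace ℝ (Fin N) → ℝ}

namespace IsNonnegWeakSolution

/-- The plane-wave identity at frequency zero, where the symbol vanishes. -/
lemma mass_eq (hu : IsNonnegWeakSolution α (-1) p u₀ u) (hα : 0 < α) (hα2 : α ≤ 2)
    (hu₀ : Integrable u₀) (hu₀n : ∀ᵐ x, 0 ≤ u₀ x) {t : ℝ} (ht : 0 < t) :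
    ∫ x, u t x = (∫ x, u₀ x) - ∫ τ in Ioc 0 t, ∫ x, u τ x ^ p := by
  have h := hu.weak_eq_re_planeWave hα hα2 hu₀ hu₀n ht 1 0
  simpa [planeWave, stableSymbol_zero hα,
    integral_prod _ (hu.integrable_pow_prod hα hα2 hu₀ hu₀n ht)] using h

lemma mass_sub (hu : IsNonnegWeakSolution α (-1) p u₀ u) (hα : 0 < α) (hα2 : α ≤ 2)
    (hu₀ : Integrable u₀) (hu₀n : ∀ᵐ x, 0 ≤ u₀ x) {s t : ℝ} (hs : 0 < s) (hst : s < t) :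
    (∫ x, u s x) - ∫ x, u t x = ∫ τ in Ioc s t, ∫ x, u τ x ^ p := by
  have hi := (hu.integrable_pow_prod hα hα2 hu₀ hu₀n (hs.trans hst)).integral_prod_left
  have hsplit := setIntegral_union (Ioc_disjoint_Ioc_of_le le_rfl) measurableSet_Ioc
    (IntegrableOn.mono_set hi (Ioc_subset_Ioc_right hst.le))
    (IntegrableOn.mono_set hi (Ioc_subset_Ioc_left hs.le))
  rw [Ioc_union_Ioc_eq_Ioc hs.le hst.le] at hsplit
  rw [hu.mass_eq hα hα2 hu₀ hu₀n hs, hu.mass_eq hα hα2 hu₀ hu₀n (hs.trans hst), hsplit]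
  ring

lemma integral_pow_nonneg (hu : IsNonnegWeakSolution α (-1) p u₀ u) {τ : ℝ} (hτ : 0 < τ) :
    0 ≤ ∫ x, u τ x ^ p := by
  refine integral_nonneg_of_ae ?_
  filter_upwards [hu.nonneg τ hτ] with x hx
  exact Real.rpow_nonneg hx p

lemma mass_nonneg (hu : IsNonnegWeakSolution α (-1) p u₀ u) {t : ℝ} (ht : 0 < t) :
    0 ≤ ∫ x, u t x := integral_nonneg_of_ae (hu.nonneg t ht)

lemma mass_antitone (hu : IsNonnegWeakSolution α (-1) p u₀ u) (hα : 0 < α) (hα2 : α ≤ 2)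
    (hu₀ : Integrable u₀) (hu₀n : ∀ᵐ x, 0 ≤ u₀ x) {s t : ℝ} (hs : 0 < s) (hst : s ≤ t) :
    ∫ x, u t x ≤ ∫ x, u s x := by
  rcases hst.eq_or_lt with rfl | hst
  · exact le_rfl
  · rw [← sub_nonneg, hu.mass_sub hα hα2 hu₀ hu₀n hs hst]
    exact setIntegral_nonneg measurableSet_Ioc fun τ hτ => hu.integral_pow_nonneg (hs.trans hτ.1)

lemma mass_le (hu : IsNonnegWeakSolution α (-1) p u₀ u) (hα : 0 < α) (hα2 : α ≤ 2)
    (hu₀ : Integrable u₀) (hu₀n : ∀ᵐ x, 0 ≤ u₀ x) {t : ℝ} (ht : 0 < t) :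
    ∫ x, u t x ≤ ∫ x, u₀ x := by
  rw [hu.mass_eq hα hα2 hu₀ hu₀n ht]
  exact sub_le_self _ (setIntegral_nonneg measurableSet_Ioc fun τ hτ =>
    hu.integral_pow_nonneg hτ.1)

/-- The `L¹`–`L^∞` smoothing estimate inherited from the linear semigroup. -/
lemma exists_ae_le_mul_rpow (hu : IsNonnegWeakSolution α (-1) p u₀ u) (hα : 0 < α) (hα2 : α ≤ 2)
    (hu₀ : Integrable u₀) (hu₀n : ∀ᵐ x, 0 ≤ u₀ x) :
    ∃ A, 0 ≤ A ∧ ∀ t, 0 < t → ∀ᵐ x, u t x ≤ A * t ^ (-((N : ℝ) / α)) := by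
  have hP := fundSol_nonneg hα hα2 one_pos (0 : EuclideanSpace ℝ (Fin N))
  have hM : 0 ≤ ∫ x, u₀ x := integral_nonneg_of_ae hu₀n
  -- The comparison is available only from positive times, so it is started at `t / 2`; this
  -- produces the power of `2⁻¹`.
  refine ⟨(2 : ℝ)⁻¹ ^ (-((N : ℝ) / α)) * fundSol α 1 (0 : EuclideanSpace ℝ (Fin N)) * ∫ x, u₀ x,
    by positivity, fun t ht => ?_⟩
  have ht2 : 0 < t / 2 := by linarith
  filter_upwards [hu.ae_le_heatConv hα hα2 hu₀ hu₀n ht2 (by linarith : t / 2 < t)] with x hx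
  rw [sub_half] at hx
  refine (hx.trans (heatConv_le hα hα2 ht2 (hu.integrable_slice _ ht2) (hu.nonneg _ ht2) x)).trans
    ((mul_le_mul_of_nonneg_left (hu.mass_le hα hα2 hu₀ hu₀n ht2)
      (fundSol_nonneg hα hα2 ht2 _)).trans_eq ?_)
  rw [fundSol_zero hα ht2, div_eq_mul_inv, Real.mul_rpow ht.le (by positivity)]
  ring

/-- The dissipation rate is controlled by an integrable power of time multiplied by the mass. -/
lemma exists_mass_sub_le (hu : IsNonnegWeakSolution α (-1) p u₀ u) (hα : 0 < α) (hα2 : α ≤ 2)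
    (hp : 1 < p) (hu₀ : Integrable u₀) (hu₀n : ∀ᵐ x, 0 ≤ u₀ x) :
    ∃ D, 0 ≤ D ∧ ∀ s t, 0 < s → s < t → (∫ x, u s x) - ∫ x, u t x
      ≤ (∫ x, u s x) * (D * ∫ τ in Ioc s t, τ ^ (-((N : ℝ) / α * (p - 1)))) := by
  obtain ⟨A, hA, hAu⟩ := hu.exists_ae_le_mul_rpow hα hα2 hu₀ hu₀n
  refine ⟨A ^ (p - 1), Real.rpow_nonneg hA _, fun s t hs hst => ?_⟩
  have hrate : ∀ τ ∈ Ioc s t, ∫ x, u τ x ^ p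
      ≤ (∫ x, u s x) * (A ^ (p - 1) * τ ^ (-((N : ℝ) / α * (p - 1)))) := by
    intro τ hτ
    have hτ0 : 0 < τ := hs.trans hτ.1
    have hB : 0 ≤ A * τ ^ (-((N : ℝ) / α)) := by positivity
    have e : (A * τ ^ (-((N : ℝ) / α))) ^ (p - 1)
        = A ^ (p - 1) * τ ^ (-((N : ℝ) / α * (p - 1))) := by
      rw [Real.mul_rpow hA (by positivity), ← Real.rpow_mul hτ0.le, neg_mul]
    rw [← e]
    calc ∫ x, u τ x ^ p ≤ ∫ x, u τ x * (A * τ ^ (-((N : ℝ) / α))) ^ (p - 1) := by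
          refine integral_mono_of_nonneg ?_ ((hu.integrable_slice τ hτ0).mul_const _) ?_
          · filter_upwards [hu.nonneg τ hτ0] with x hx
            exact Real.rpow_nonneg hx p
          · filter_upwards [hu.nonneg τ hτ0, hAu τ hτ0] with x hx hxA
            have : u τ x ^ p = u τ x * u τ x ^ (p - 1) := by
              rw [mul_comm, ← Real.rpow_add_one' hx (by linarith), sub_add_cancel]
            rw [this]
            exact mul_le_mul_of_nonneg_left (Real.rpow_le_rpow hx hxA (by linarith)) hx
      _ = (∫ x, u τ x) * (A * τ ^ (-((N : ℝ) / α))) ^ (p - 1) := integral_mul_const _ _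
      _ ≤ _ := mul_le_mul_of_nonneg_right (hu.mass_antitone hα hα2 hu₀ hu₀n hs hτ.1.le)
          (Real.rpow_nonneg hB _)
  have hi : IntegrableOn (fun τ : ℝ => τ ^ (-((N : ℝ) / α * (p - 1)))) (Ioc s t) := by
    refine (ContinuousOn.integrableOn_Icc (ContinuousOn.rpow_const continuousOn_id fun τ hτ =>
      Or.inl (hs.trans_le hτ.1).ne')).mono_set Ioc_subset_Icc_self
  rw [hu.mass_sub hα hα2 hu₀ hu₀n hs hst, ← integral_const_mul, ← integral_const_mul]
  refine setIntegral_mono_on ?_ ((hi.const_mul _).const_mul _) measurableSet_Ioc hrate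
  exact IntegrableOn.mono_set
    (hu.integrable_pow_prod hα hα2 hu₀ hu₀n (hs.trans hst)).integral_prod_left
    (Ioc_subset_Ioc_left hs.le)

/-- If the mass vanished at all positive times, so would the dissipation, and the mass balance would
force `∫ u₀ = 0`. -/
lemma exists_mass_pos (hu : IsNonnegWeakSolution α (-1) p u₀ u) (hα : 0 < α) (hα2 : α ≤ 2)
    (hp : 1 < p) (hu₀ : Integrable u₀) (hu₀n : ∀ᵐ x, 0 ≤ u₀ x) (hu₀0 : ¬ u₀ =ᵐ[volume] 0) :
    ∃ s, 0 < s ∧ 0 < ∫ x, u s x := by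
  by_contra! hcon
  have hz : ∀ s, 0 < s → ∫ x, u s x = 0 := fun s hs => le_antisymm (hcon s hs) (hu.mass_nonneg hs)
  have hpow : ∀ τ ∈ Ioc (0 : ℝ) 1, ∫ x, u τ x ^ p = 0 := by
    intro τ hτ
    have h := (integral_eq_zero_iff_of_nonneg_ae (hu.nonneg τ hτ.1)
      (hu.integrable_slice τ hτ.1)).1 (hz τ hτ.1)
    refine integral_eq_zero_of_ae ?_
    filter_upwards [h] with x hx
    rw [hx, Pi.zero_apply, Real.zero_rpow (by linarith)]
  have h := hu.mass_eq hα hα2 hu₀ hu₀n one_pos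
  rw [hz 1 one_pos, setIntegral_congr_fun measurableSet_Ioc hpow, integral_zero, sub_zero] at h
  exact hu₀0 ((integral_eq_zero_iff_of_nonneg_ae hu₀n hu₀).1 h.symm)

/-- After a time `s₀` of positive mass, a step of length `h` costs at most the fraction `K h < 1` of
the current mass. Finitely many steps pass any given time, and monotonicity covers the times in
between. -/
lemma mass_pos (hu : IsNonnegWeakSolution α (-1) p u₀ u) (hα : 0 < α) (hα2 : α ≤ 2)
    (hp : 1 < p) (hu₀ : Integrable u₀) (hu₀n : ∀ᵐ x, 0 ≤ u₀ x) (hu₀0 : ¬ u₀ =ᵐ[volume] 0)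
    {t : ℝ} (ht : 0 < t) : 0 < ∫ x, u t x := by
  obtain ⟨s₀, hs₀, hpos⟩ := hu.exists_mass_pos hα hα2 hp hu₀ hu₀n hu₀0
  obtain ⟨D, hD, hDu⟩ := hu.exists_mass_sub_le hα hα2 hp hu₀ hu₀n
  set γ := (N : ℝ) / α * (p - 1) with hγ
  have hγ0 : 0 ≤ γ := mul_nonneg (by positivity) (by linarith)
  set K := D * s₀ ^ (-γ) with hK
  have hK0 : 0 ≤ K := by positivity
  -- The added `1` keeps `h` finite when `K = 0` and makes `K h < 1` strict.
  set h := 1 / (K + 1) with hh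
  have hh0 : 0 < h := by positivity
  have hKh : K * h < 1 := by
    rw [hh, mul_one_div, div_lt_one (by positivity)]
    linarith
  have hstep : ∀ s, s₀ ≤ s → 0 < ∫ x, u s x → 0 < ∫ x, u (s + h) x := by
    intro s hs hsp
    have hs0 : 0 < s := hs₀.trans_le hs
    have h1 := hDu s (s + h) hs0 (by linarith)
    have h2 : ∫ τ in Ioc s (s + h), τ ^ (-γ) ≤ s₀ ^ (-γ) * h := by
      have h3 : ∀ τ ∈ Ioc s (s + h), ‖τ ^ (-γ)‖ ≤ s₀ ^ (-γ) := fun τ hτ => by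
        rw [Real.norm_of_nonneg (Real.rpow_nonneg (hs0.trans hτ.1).le _)]
        exact Real.rpow_le_rpow_of_nonpos hs₀ (hs.trans hτ.1.le) (by linarith)
      have h4 := norm_setIntegral_le_of_norm_le_const (μ := volume) (by simp) h3
      refine (le_abs_self _).trans (h4.trans_eq ?_)
      simp [measureReal_def, hh0.le]
    have h5 : D * ∫ τ in Ioc s (s + h), τ ^ (-γ) ≤ K * h := by
      rw [hK, mul_assoc]
      exact mul_le_mul_of_nonneg_left h2 hD
    have h6 := mul_le_mul_of_nonneg_left h5 hsp.le
    nlinarith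
  have hind : ∀ n : ℕ, 0 < ∫ x, u (s₀ + n * h) x := by
    intro n
    induction n with
    | zero => simpa using hpos
    | succ n ih =>
      have := hstep (s₀ + n * h) (by have : 0 ≤ (n : ℝ) * h := by positivity
                                     linarith) ih
      rw [show s₀ + ((n + 1 : ℕ) : ℝ) * h = s₀ + n * h + h by push_cast; ring]
      exact this
  obtain ⟨n, hn⟩ := exists_nat_ge (t / h)
  refine (hind n).trans_le (hu.mass_antitone hα hα2 hu₀ hu₀n ht ?_)
  rw [div_le_iff₀ hh0] at hn
  linarith

/-- The mass is nonincreasing, so only positivity of the limit is at stake. Since `γ > 1`, the rate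
`τ^{-γ}` is integrable at infinity, and from a late time `s` on at most half of the mass can be
lost. -/
lemma exists_tendsto_mass (hu : IsNonnegWeakSolution α (-1) p u₀ u) (hα : 0 < α) (hα2 : α ≤ 2)
    (hp : 1 < p) (hγ : 1 < (N : ℝ) / α * (p - 1)) (hu₀ : Integrable u₀)
    (hu₀n : ∀ᵐ x, 0 ≤ u₀ x) (hu₀0 : ¬ u₀ =ᵐ[volume] 0) :
    ∃ M : ℝ, 0 < M ∧ Tendsto (fun t : ℝ => ∫ x, u t x) atTop (𝓝 M) ∧
      ∀ t, 0 < t → M ≤ ∫ x, u t x := by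
  obtain ⟨D, hD, hDu⟩ := hu.exists_mass_sub_le hα hα2 hp hu₀ hu₀n
  set γ := (N : ℝ) / α * (p - 1) with hγdef
  -- The quotient is the value of `∫_s^∞ τ^{-γ} dτ`.
  obtain ⟨s, hs0, hs⟩ : ∃ s : ℝ, 0 < s ∧ D * (-s ^ (-γ + 1) / (-γ + 1)) < 1 / 2 := by
    have h : Tendsto (fun s : ℝ => D * (-s ^ (-(γ - 1)) / (-γ + 1))) atTop (𝓝 0) := by
      simpa using ((tendsto_rpow_neg_atTop (by linarith : 0 < γ - 1)).neg.div_const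
        (-γ + 1)).const_mul D
    obtain ⟨s, hs1, hs2⟩ := ((eventually_gt_atTop 0).and
      (h.eventually_lt_const (by norm_num : (0 : ℝ) < 1 / 2))).exists
    exact ⟨s, hs1, by rwa [show -γ + 1 = -(γ - 1) by ring] at hs2 ⊢⟩
  have hsp := hu.mass_pos hα hα2 hp hu₀ hu₀n hu₀0 hs0
  have hlow : ∀ t, s < t → (∫ x, u s x) / 2 ≤ ∫ x, u t x := by
    intro t hst
    have h1 := hDu s t hs0 hst
    have h2 : ∫ τ in Ioc s t, τ ^ (-γ) ≤ -s ^ (-γ + 1) / (-γ + 1) := by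
      rw [← integral_Ioi_rpow_of_lt (by linarith) hs0]
      refine setIntegral_mono_set (integrableOn_Ioi_rpow_of_lt (by linarith) hs0) ?_
        Ioc_subset_Ioi_self.eventuallyLE
      filter_upwards [ae_restrict_mem measurableSet_Ioi] with τ hτ
      exact Real.rpow_nonneg (hs0.trans hτ).le _
    have h3 := mul_le_mul_of_nonneg_left
      ((mul_le_mul_of_nonneg_left h2 hD).trans hs.le) hsp.le
    linarith
  -- Nothing is known at nonpositive times; truncating at `1` gives a function monotone on the whole
  -- line with the same limit.
  have hanti : Antitone fun t : ℝ => ∫ x, u (max t 1) x := fun a b hab =>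
    hu.mass_antitone hα hα2 hu₀ hu₀n (by positivity) (max_le_max_right 1 hab)
  have hbdd : BddBelow (range fun t : ℝ => ∫ x, u (max t 1) x) :=
    ⟨0, by rintro _ ⟨t, rfl⟩; exact hu.mass_nonneg (by positivity)⟩
  have hlim : Tendsto (fun t : ℝ => ∫ x, u t x) atTop (𝓝 (⨅ t : ℝ, ∫ x, u (max t 1) x)) := by
    refine (tendsto_atTop_ciInf hanti hbdd).congr' ?_
    filter_upwards [eventually_ge_atTop 1] with t ht
    rw [max_eq_left ht]
  refine ⟨_, ?_, hlim, fun t ht => ?_⟩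
  · refine (half_pos hsp).trans_le (ge_of_tendsto hlim ?_)
    filter_upwards [eventually_gt_atTop s] with t ht
    exact hlow t ht
  · refine le_of_tendsto hlim ?_
    filter_upwards [eventually_ge_atTop t] with t' ht'
    exact hu.mass_antitone hα hα2 hu₀ hu₀n ht ht'

/-- Insert the linear flow started from `u(s)` and its profile `M(s) P_α(t)`. For `s` late and then
`t` large, each of the three resulting distances is below `δ / 4`. -/
lemma tendsto_integral_abs_sub (hu : IsNonnegWeakSolution α (-1) p u₀ u) (hα : 0 < α)
    (hα2 : α ≤ 2) (hu₀ : Integrable u₀) (hu₀n : ∀ᵐ x, 0 ≤ u₀ x) {M : ℝ}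
    (hM : Tendsto (fun t : ℝ => ∫ x, u t x) atTop (𝓝 M)) (hMle : ∀ t, 0 < t → M ≤ ∫ x, u t x) :
    Tendsto (fun t : ℝ => ∫ x, |u t x - M * fundSol α t x|) atTop (𝓝 0) := by
  refine Metric.tendsto_atTop.2 fun δ hδ => ?_
  obtain ⟨s, hs0, hs⟩ := ((eventually_gt_atTop 0).and
    (hM.eventually_lt_const (by linarith : M < M + δ / 4))).exists
  obtain ⟨T, hT⟩ := ((tendsto_integral_abs_heatConv_sub hα hα2 s
    (hu.integrable_slice s hs0)).eventually_lt_const (by linarith : 0 < δ / 4)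
    ).exists_forall_of_atTop
  refine ⟨max T (s + 1), fun t ht => ?_⟩
  have hst : s < t := by linarith [(le_max_right T (s + 1)).trans ht]
  have ht0 := hs0.trans hst
  have h1 := hT t ((le_max_left _ _).trans ht)
  have hus := hu.integrable_slice s hs0
  have hut := hu.integrable_slice t ht0
  have hw := integrable_heatConv hα hα2 (sub_pos.2 hst) hus
  have hP := integrable_fundSol (N := N) hα hα2 ht0
  -- The two functions are ordered and the linear flow conserves mass, so their distance is exactly
  -- the mass lost.
  have e1 : ∫ x, |heatConv α (t - s) (u s) x - u t x| = (∫ x, u s x) - ∫ x, u t x := by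
    rw [← integral_heatConv hα hα2 (sub_pos.2 hst) hus, ← integral_sub hw hut]
    refine integral_congr_ae ?_
    filter_upwards [hu.ae_le_heatConv hα hα2 hu₀ hu₀n hs0 hst] with x hx
    exact abs_of_nonneg (sub_nonneg.2 hx)
  have e2 : ∫ x : EuclideanSpace ℝ (Fin N), |((∫ y, u s y) - M) * fundSol α t x|
      = (∫ y, u s y) - M := by
    have : ∀ x : EuclideanSpace ℝ (Fin N), |((∫ y, u s y) - M) * fundSol α t x|
        = ((∫ y, u s y) - M) * fundSol α t x := fun x =>
      abs_of_nonneg (mul_nonneg (sub_nonneg.2 (hMle s hs0)) (fundSol_nonneg hα hα2 ht0 x))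
    simp_rw [this]
    rw [integral_const_mul, integral_fundSol hα hα2 ht0, mul_one]
  have i1 := (hw.sub hut).abs
  have i2 := (hw.sub (hP.const_mul (∫ y, u s y))).abs
  have i3 := (hP.const_mul ((∫ y, u s y) - M)).abs
  have h2 : ∫ x, |u t x - M * fundSol α t x|
      ≤ ∫ x, (|heatConv α (t - s) (u s) x - u t x|
        + |heatConv α (t - s) (u s) x - (∫ y, u s y) * fundSol α t x|
        + |((∫ y, u s y) - M) * fundSol α t x|) := by
    refine integral_mono (hut.sub (hP.const_mul M)).abs ((i1.add i2).add i3) fun x => ?_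
    have : u t x - M * fundSol α t x = -(heatConv α (t - s) (u s) x - u t x)
        + (heatConv α (t - s) (u s) x - (∫ y, u s y) * fundSol α t x)
        + ((∫ y, u s y) - M) * fundSol α t x := by ring
    simp only
    rw [this]
    refine (abs_add_three _ _ _).trans_eq ?_
    rw [abs_neg]
  have h3 : ∫ x, (|heatConv α (t - s) (u s) x - u t x|
        + |heatConv α (t - s) (u s) x - (∫ y, u s y) * fundSol α t x|
        + |((∫ y, u s y) - M) * fundSol α t x|)
      = ((∫ x, u s x) - ∫ x, u t x)
        + (∫ x, |heatConv α (t - s) (u s) x - (∫ y, u s y) * fundSol α t x|)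
        + ((∫ y, u s y) - M) := by
    exact ((integral_add (i1.add i2) i3).trans (congrArg (· + _) (integral_add i1 i2))).trans
      (congrArg₂ (· + ·) (congrArg (· + _) e1) e2)
  rw [Real.dist_0_eq_abs, abs_of_nonneg (integral_nonneg fun x => abs_nonneg _)]
  have := hMle t ht0
  linarith

end IsNonnegWeakSolution

end Asymptotics

/-! ### Conclusion: interpolation to `L^q` -/

theorem theorem1 (N : ℕ) (hN : 1 ≤ N) (α : ℝ) (hα₀ : 0 < α) (hα₂ : α ≤ 2)
    (p : ℝ) (hp : 1 + α / (N : ℝ) < p)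
    (u₀ : EuclideanSpace ℝ (Fin N) → ℝ) (hu₀_int : Integrable u₀)
    (hu₀_nonneg : ∀ᵐ x, 0 ≤ u₀ x) (hu₀_ne : ¬ (u₀ =ᵐ[volume] 0))
    (u : ℝ → EuclideanSpace ℝ (Fin N) → ℝ)
    (hu : IsNonnegWeakSolution α (-1) p u₀ u) :
    ∃ M : ℝ, 0 < M ∧ Tendsto (fun t : ℝ => ∫ x, u t x) atTop (𝓝 M) ∧
      ∀ q : ℝ, 1 ≤ q →
        Tendsto (fun t : ℝ => ENNReal.ofReal (t ^ ((N : ℝ) / α * (1 - 1 / q))) *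
            eLpNorm (fun x => u t x - M * fundSol α t x) (ENNReal.ofReal q) volume)
          atTop (𝓝 0) := by
  have hN0 : (0 : ℝ) < N := by exact_mod_cast hN
  have hp1 : 1 < p := by
    have : 0 < α / (N : ℝ) := by positivity
    linarith
  have hγ : 1 < (N : ℝ) / α * (p - 1) := by
    have h1 : α / (N : ℝ) < p - 1 := by linarith
    have h2 := mul_lt_mul_of_pos_left h1 (show 0 < (N : ℝ) / α by positivity)
    rwa [div_mul_div_cancel₀ hα₀.ne', div_self hN0.ne'] at h2
  obtain ⟨M, hM0, hM, hMle⟩ := hu.exists_tendsto_mass hα₀ hα₂ hp1 hγ hu₀_int hu₀_nonneg hu₀_ne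
  refine ⟨M, hM0, hM, fun q hq => ?_⟩
  have hq0 : 0 < q := zero_lt_one.trans_le hq
  have hL1 := hu.tendsto_integral_abs_sub hα₀ hα₂ hu₀_int hu₀_nonneg hM hMle
  obtain ⟨A, hA, hAu⟩ := hu.exists_ae_le_mul_rpow hα₀ hα₂ hu₀_int hu₀_nonneg
  have hP1 := fundSol_nonneg hα₀ hα₂ one_pos (0 : EuclideanSpace ℝ (Fin N))
  -- In units of `t^{-N/α}`, this bounds the solution and the profile together.
  set A' := A + M * fundSol α 1 (0 : EuclideanSpace ℝ (Fin N)) with hA'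
  have hA'0 : 0 ≤ A' := by positivity
  have hlim : Tendsto (fun t : ℝ => ENNReal.ofReal (A' ^ (1 - 1 / q) *
      (∫ x, |u t x - M * fundSol α t x|) ^ (1 / q))) atTop (𝓝 0) := by
    have h1 := hL1.rpow_const (p := 1 / q) (Or.inr (by positivity))
    rw [Real.zero_rpow (by positivity)] at h1
    have h2 := h1.const_mul (A' ^ (1 - 1 / q))
    rw [mul_zero] at h2
    simpa [Function.comp_def] using (ENNReal.continuous_ofReal.tendsto 0).comp h2
  refine tendsto_of_tendsto_of_tendsto_of_le_of_le' tendsto_const_nhds hlim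
    (Eventually.of_forall fun t => zero_le) ?_
  filter_upwards [eventually_gt_atTop 0] with t ht
  have hbound : ∀ᵐ x, |u t x - M * fundSol α t x| ≤ A' * t ^ (-((N : ℝ) / α)) := by
    filter_upwards [hu.nonneg t ht, hAu t ht] with x hx0 hxA
    have h1 := fundSol_nonneg hα₀ hα₂ ht x
    have h2 := mul_le_mul_of_nonneg_left (fundSol_le hα₀ ht x) hM0.le
    rw [fundSol_zero hα₀ ht] at h2
    have h3 := mul_nonneg hM0.le h1
    have h4 : 0 ≤ t ^ (-((N : ℝ) / α)) := Real.rpow_nonneg ht.le _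
    have h5 : 0 ≤ A * t ^ (-((N : ℝ) / α)) := mul_nonneg hA h4
    rw [hA', add_mul]
    refine abs_le.2 ⟨?_, ?_⟩ <;> nlinarith
  have hint : Integrable fun x => u t x - M * fundSol α t x :=
    (hu.integrable_slice t ht).sub ((integrable_fundSol hα₀ hα₂ ht).const_mul M)
  have hB : 0 ≤ A' * t ^ (-((N : ℝ) / α)) := mul_nonneg hA'0 (Real.rpow_nonneg ht.le _)
  refine (mul_le_mul_right (eLpNorm_le_of_ae_bound_of_integrable hint hB hq hbound) _).trans_eq ?_
  rw [← ENNReal.ofReal_mul (Real.rpow_nonneg ht.le _), Real.mul_rpow hA'0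
    (Real.rpow_nonneg ht.le _), ← Real.rpow_mul ht.le]
  -- The weight in the statement exactly cancels the decay contributed by the `L^∞` bound, leaving a
  -- power of the `L¹` norm.
  have e : t ^ ((N : ℝ) / α * (1 - 1 / q)) * t ^ (-((N : ℝ) / α) * (1 - 1 / q)) = 1 := by
    rw [← Real.rpow_add ht, neg_mul, add_neg_cancel, Real.rpow_zero]
  congr 1
  linear_combination (A' ^ (1 - 1 / q) * (∫ x, |u t x - M * fundSol α t x|) ^ (1 / q)) * e
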